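/- **Setting.** Let $\alpha\ge 0$, $g\in\mathbb R$, $0<\Lambda<\infty$. For $n\ge 0$ particles in $\mathbb R^3$ let $\mathcal H_n=\bigwedge^n L^2(\mathbb R^3;\mathbb C^2)\otimes\mathcal F$ (spin-$\tfrac12$ fermions), where $\mathcal F$ is the bosonic Fock space over $L^2(\mathbb R^3;\mathbb C^2)$ (photons with two polarizations, annihilation operators $a_\lambda(k)$); alternatively the particles are spinless, $\bigwedge^n L^2(\mathbb R^3;\mathbb C^2)$ is replaced by the symmetric subspace of $\bigotimes^nL^2(\mathbb R^3)$ or by all of $\bigotimes^nL^2(\mathbb R^3)$, and the spin term below is absent. Let $v:\mathbb R^3\to\mathbb R$ be measurable and $V(X)=\sum_{j=1}^n v(x_j)$ for $X=(x_1,\dots,x_n)$; for each $n$ let $I=I_n:(\mathbb R^3)^n\to\mathbb R$ be measurable, symmetric and invariant under simultaneous translation of all particles. For $m\ge 0$ let $$H^V_m=\sum_{j=1}^n\Big\{\big(p_j+\sqrt\alpha\,A(x_j)\big)^2+\tfrac g2\sqrt\alpha\,\sigma_j\cdot B(x_j)\Big\}+V(X)+I(X)+H_f(m),$$ $$A(x)=\sum_{\lambda=1,2}\int_{|k|<\Lambda}\frac{1}{\sqrt{|k|}}\,\varepsilon_\lambda(k)\big[e^{ik\cdot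 x}a_\lambda(k)+e^{-ik\cdot x}a^*_\lambda(k)\big]dk,\qquad B=\operatorname{curl}A,$$ $$H_f(m)=\sum_{\lambda=1,2}\int_{\mathbb R^3}\sqrt{k^2+m^2}\;a^*_\lambda(k)a_\lambda(k)\,dk,$$ with $p=-i\nabla$, $\sigma_j$ the Pauli matrices of particle $j$, $\varepsilon_1(k)=(k_2,-k_1,0)/\sqrt{k_1^2+k_2^2}$ and $\varepsilon_2(k)=\frac{k}{|k|}\wedge\varepsilon_1(k)$. Let $E^V(m,n)$ be the bottom of the spectrum of $H^V_m$ on $\mathcal H_n$, i.e. the infimum of $(\Phi,H^V_m\Phi)$ over the normalized $\Phi$ in its form domain (the $\Phi\in\mathcal H_n$ such that all $p_j\Phi$ are square integrable and $H_f(m)$, $|V|$, $|I|$ have finite expectation in $\Phi$), with $\inf\emptyset=+\infty$. Let $E^0(m,n)$ be the same quantity with $v=0$. **Lemma.** Let $N\ge 0$ and assume that for every $n\le N$ and every $\delta>0$ there is $a(\delta)<\infty$ with $V_-+I_-\le\delta\sum_{j=1}^n p_j^2+a(\delta)$ as quadratic forms on $\mathcal H_n$, where $V_-,I_-\ge0$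 are the negative parts. Let $\varepsilon>0$ and assume that $$E^V(0,N)<\min\{E^V(0,N')+E^0(0,N-N'):\ 0\le N'<N\}-2\varepsilon .$$ Then there is $m_0>0$ such that for all $0<m<m_0$ $$E^V(m,N)<\min\{E^V(m,N')+E^0(m,N-N'):\ 0\le N'<N\}-\varepsilon .$$ (The minimum over the empty set is $+\infty$.) -/

import Mathlib

open MeasureTheory
open scoped ENNReal NNReal ContDiff ComplexConjugate Matrix

noncomputable section

namespace QED

/-- Physical space and photon wave-number space `ℝ³`. -/
abbrev E3 : Type := EuclideanSpace ℝ (Fin 3)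

/-- The particle statistics: spin-1/2 fermions, or spinless bosons, or spinless distinguishable
particles (Boltzmann statistics). -/
inductive Statistics : Type
  | fermi
  | bose
  | boltzmann

/-- Number of spin components of one particle. -/
def Statistics.spinDim : Statistics → ℕ
  | .fermi => 2
  | .bose => 1
  | .boltzmann => 1

/-- The three spin matrices: the Pauli matrices for spin-1/2 fermions, and zero for the spinless
particles (so that they carry no spin coupling). -/
def Statistics.spinMatrix :
    (S : Statistics) → Fin 3 → Matrix (Fin S.spinDim) (Fin S.spinDim) ℂ
  | .fermi => fun i =>
      (![!![0, 1; 1, 0], !![0, -Complex.I; Complex.I, 0], !![1, 0; 0, -1]] :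
        Fin 3 → Matrix (Fin 2) (Fin 2) ℂ) i
  | .bose => fun _ => 0
  | .boltzmann => fun _ => 0

/-- Positions of `N` particles and wave numbers of `n` photons. -/
abbrev Config (N n : ℕ) : Type := (Fin N → E3) × (Fin n → E3)

/-- Wave functions of `N` particles with `d` spin components each and an arbitrary number of
photons. `Φ n s l (X, K)` is the `n`-photon amplitude at particle spins `s`, photon
polarizations `l`, particle positions `X` and photon wave numbers `K`. -/
abbrev Wave (N d : ℕ) : Type :=
  (n : ℕ) → (Fin N → Fin d) → (Fin n → Fin 2) → Config N n → ℂ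

variable {N d : ℕ}

/-- `∑ₙ ∑ₛ ∑ₗ ∫ wₙ(X, K) |Φₙ(X, s, K, l)|² dX dK` for a weight `w ≥ 0`. -/
def weighted (w : (n : ℕ) → Config N n → ℝ≥0∞) (Φ : Wave N d) : ℝ≥0∞ :=
  ∑' n : ℕ, ∑ s : Fin N → Fin d, ∑ l : Fin n → Fin 2,
    ∫⁻ z : Config N n, w n z * ‖Φ n s l z‖ₑ ^ 2

/-- The squared norm in `L²(particles and spins) ⊗ Fock space`. -/
def normSq (Φ : Wave N d) : ℝ≥0∞ := weighted (fun _ _ => 1) Φ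

/-- The inner product, antilinear in the first argument. -/
def innerProd (Φ Ψ : Wave N d) : ℂ :=
  ∑' n : ℕ, ∑ s : Fin N → Fin d, ∑ l : Fin n → Fin 2,
    ∫ z : Config N n, conj (Φ n s l z) * Ψ n s l z

/-- The behaviour under permutations of the particles (positions and spins together):
antisymmetric, symmetric, or unrestricted. -/
def HasStatistics (S : Statistics) (Φ : Wave N d) : Prop :=
  match S with
  | .fermi => ∀ (τ : Equiv.Perm (Fin N)) n s l X K,
      Φ n (s ∘ τ) l (X ∘ τ, K) = ((Equiv.Perm.sign τ : ℤ) : ℂ) * Φ n s l (X, K)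
  | .bose => ∀ (τ : Equiv.Perm (Fin N)) n s l X K,
      Φ n (s ∘ τ) l (X ∘ τ, K) = Φ n s l (X, K)
  | .boltzmann => True

/-- `Φ` is a vector of the Hilbert space of `N` particles of statistics `S` and any number of
photons: square integrable, with the statistics of the particles, and symmetric in the photons.
Vectors are given by functions; each class of functions modulo null sets that has the symmetries
almost everywhere contains a measurable function that has them everywhere. -/
structure IsVector (S : Statistics) (Φ : Wave N S.spinDim) : Prop where
  measurable : ∀ n s l, Measurable (Φ n s l)
  normSq_lt_top : normSq Φ < ⊤
  statistics : HasStatistics S Φ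
  photon_symm : ∀ (n : ℕ) (τ : Equiv.Perm (Fin n)) s l X K,
      Φ n s (l ∘ τ) (X, K ∘ τ) = Φ n s l (X, K)

/-- `G j i` is the weak derivative of `Φ` in the `i`-th coordinate of the position of the
particle `j`, and these derivatives are square integrable. -/
structure IsWeakGradient (Φ : Wave N d) (G : Fin N → Fin 3 → Wave N d) : Prop where
  measurable : ∀ j i n s l, Measurable (G j i n s l)
  normSq_lt_top : ∀ j i, normSq (G j i) < ⊤
  weak : ∀ (j : Fin N) (i : Fin 3) (n : ℕ) s l (φ : Config N n → ℝ),
      ContDiff ℝ ∞ φ → HasCompactSupport φ →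
      ∫ z, ((fderiv ℝ φ z (Pi.single j (EuclideanSpace.single i (1 : ℝ)), 0) : ℝ) : ℂ)
          * Φ n s l z
        = - ∫ z, ((φ z : ℝ) : ℂ) * G j i n s l z

/-- The two polarization vectors: `ε₁(k) = (k₂, -k₁, 0) / √(k₁² + k₂²)` and
`ε₂(k) = (k / |k|) ∧ ε₁(k)`. -/
def polarization (l : Fin 2) (k : E3) : Fin 3 → ℝ :=
  let e : Fin 3 → ℝ := (Real.sqrt (k 0 ^ 2 + k 1 ^ 2))⁻¹ • ![k 1, -k 0, 0]
  if l = 0 then e else crossProduct (‖k‖⁻¹ • (fun i => k i)) e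

/-- `χ(|k| < Λ) |k|^(-1/2) exp(i k·x)`. -/
def cutoffWave (Λ : ℝ) (k x : E3) : ℂ :=
  if ‖k‖ < Λ then (((Real.sqrt ‖k‖)⁻¹ : ℝ) : ℂ) * Complex.exp (Complex.I * (inner ℝ k x : ℝ))
  else 0

/-- Form factor of the `i`-th component of `A(x)`: the annihilation part of `A(x)` is
`∑ₗ ∫ aCoeff Λ i l k x aₗ(k) dk`. -/
def aCoeff (Λ : ℝ) (i : Fin 3) (l : Fin 2) (k x : E3) : ℂ :=
  (polarization l k i : ℂ) * cutoffWave Λ k x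

/-- Form factor of the `i`-th component of `B = curl A`. -/
def bCoeff (Λ : ℝ) (i : Fin 3) (l : Fin 2) (k x : E3) : ℂ :=
  Complex.I * ((crossProduct (fun i => k i) (polarization l k) i : ℝ) : ℂ) * cutoffWave Λ k x

/-- `∑ₗ ∫ c l k x_j aₗ(k) dk`, in the usual normalization
`(aₗ(k) Φ)ₙ(k₁, …, kₙ) = √(n+1) Φₙ₊₁(k, k₁, …, kₙ)`. -/
def annihilate (c : Fin 2 → E3 → E3 → ℂ) (j : Fin N) (Φ : Wave N d) : Wave N d :=
  fun n s l z => ((Real.sqrt (n + 1) : ℝ) : ℂ) *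
    ∑ q : Fin 2, ∫ k : E3, c q k (z.1 j) *
      Φ (n + 1) s (Fin.cons q l : Fin (n + 1) → Fin 2)
        (z.1, (Fin.cons k z.2 : Fin (n + 1) → E3))

/-- The adjoint `∑ₗ ∫ conj (c l k x_j) aₗ*(k) dk` of `annihilate c j`. -/
def create (c : Fin 2 → E3 → E3 → ℂ) (j : Fin N) (Φ : Wave N d) : Wave N d
  | 0 => fun _ _ _ => 0
  | n + 1 => fun s l z => (((Real.sqrt (n + 1))⁻¹ : ℝ) : ℂ) *
    ∑ r : Fin (n + 1), conj (c (l r) (z.2 r) (z.1 j)) *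
      Φ n s (r.removeNth l) (z.1, r.removeNth z.2)

/-- The field operator with form factor `c` at the position of the particle `j`; it is
`A(x_j)ᵢ` for `c = aCoeff Λ i` and `B(x_j)ᵢ` for `c = bCoeff Λ i`. -/
def field (c : Fin 2 → E3 → E3 → ℂ) (j : Fin N) (Φ : Wave N d) : Wave N d :=
  annihilate c j Φ + create c j Φ

/-- The `i`-th spin matrix acting on the spin of the particle `j`. -/
def spinOp (S : Statistics) (j : Fin N) (i : Fin 3) (Φ : Wave N S.spinDim) :
    Wave N S.spinDim :=
  fun n s l z => ∑ t : Fin S.spinDim,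
    S.spinMatrix i (s j) t * Φ n (Function.update s j t) l z

/-- The photon energy `√(k² + m²)`; it is `|k|` for `m = 0`. -/
def omega (m : ℝ) (k : E3) : ℝ := Real.sqrt (‖k‖ ^ 2 + m ^ 2)

/-- The expectation of the field energy `H_f(m)`. -/
def fieldEnergy (m : ℝ) (Φ : Wave N d) : ℝ≥0∞ :=
  weighted (fun _ z => ∑ r, ENNReal.ofReal (omega m (z.2 r))) Φ

/-- The expectation of `∑ⱼ (pⱼ + √α A(xⱼ))²`, with `p = -i∇`, for `Φ` with weak gradient `G`. -/
def kineticEnergy (α Λ : ℝ) (Φ : Wave N d) (G : Fin N → Fin 3 → Wave N d) : ℝ≥0∞ :=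
  ∑ j : Fin N, ∑ i : Fin 3,
    normSq ((-Complex.I) • G j i + ((Real.sqrt α : ℝ) : ℂ) • field (aCoeff Λ i) j Φ)

/-- The expectation of `(g/2) √α ∑ⱼ σⱼ · B(xⱼ)`. -/
def spinEnergy (S : Statistics) (α g Λ : ℝ) (Φ : Wave N S.spinDim) : ℝ :=
  g / 2 * Real.sqrt α *
    ∑ j : Fin N, ∑ i : Fin 3, (innerProd Φ (spinOp S j i (field (bCoeff Λ i) j Φ))).re

/-- The expectation of the multiplication by a real function of the particle positions. -/
def potentialEnergy (W : (Fin N → E3) → ℝ) (Φ : Wave N d) : ℝ :=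
  ∑' n : ℕ, ∑ s : Fin N → Fin d, ∑ l : Fin n → Fin 2,
    ∫ z : Config N n, W z.1 * ‖Φ n s l z‖ ^ 2

/-- The external potential `V(X) = ∑ⱼ v(xⱼ)`. -/
def externalPotential (N : ℕ) (v : E3 → ℝ) (X : Fin N → E3) : ℝ := ∑ j, v (X j)

/-- `Φ`, with weak gradient `G`, belongs to the form domain of the Hamiltonian of `N` particles
with photon mass `m`, external one-body potential `v` and interaction `I`: all `pⱼ Φ` are square
integrable and the field energy, the external potential and the interaction have finite
expectation in `Φ`. (By `A², B² ≤ const (H_f + 1)` the remaining terms are then finite, too.) -/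
structure InFormDomain (S : Statistics) (m : ℝ) (v : E3 → ℝ) (I : (Fin N → E3) → ℝ)
    (Φ : Wave N S.spinDim) (G : Fin N → Fin 3 → Wave N S.spinDim) : Prop where
  isVector : IsVector S Φ
  isWeakGradient : IsWeakGradient Φ G
  field_lt_top : fieldEnergy m Φ < ⊤
  external_lt_top : weighted (fun _ z => ‖externalPotential N v z.1‖ₑ) Φ < ⊤
  interaction_lt_top : weighted (fun _ z => ‖I z.1‖ₑ) Φ < ⊤

/-- The quadratic form `(Φ, H Φ)` of the Hamiltonian
`H = ∑ⱼ {(pⱼ + √α A(xⱼ))² + (g/2) √α σⱼ · B(xⱼ)} + V(X) + I(X) + H_f(m)`. -/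
def energyForm (S : Statistics) (α g Λ m : ℝ) (v : E3 → ℝ) (I : (Fin N → E3) → ℝ)
    (Φ : Wave N S.spinDim) (G : Fin N → Fin 3 → Wave N S.spinDim) : EReal :=
  (kineticEnergy α Λ Φ G : EReal) + (spinEnergy S α g Λ Φ : EReal)
    + (potentialEnergy (externalPotential N v) Φ : EReal) + (potentialEnergy I Φ : EReal)
    + (fieldEnergy m Φ : EReal)

/-- The ground state energy `E^V(m, N)` for the external one-body potential `v`: the bottom of
the spectrum of the Hamiltonian, i.e. the infimum of its quadratic form over the normalized
vectors of its form domain. It is an extended real number, so that no convention on unbounded or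
empty sets of real numbers enters. The energy `E^0(m, N)` is the case `v = 0`. -/
def groundEnergy (S : Statistics) (α g Λ : ℝ) (I : (n : ℕ) → (Fin n → E3) → ℝ)
    (v : E3 → ℝ) (m : ℝ) (N : ℕ) : EReal :=
  sInf {e : EReal | ∃ (Φ : Wave N S.spinDim) (G : Fin N → Fin 3 → Wave N S.spinDim),
    InFormDomain S m v (I N) Φ G ∧ normSq Φ = 1 ∧ e = energyForm S α g Λ m v (I N) Φ G}

/-- The two-cluster threshold `min {E^V(m, N') + E^0(m, N - N') : N' < N}`. -/
def threshold (S : Statistics) (α g Λ : ℝ) (I : (n : ℕ) → (Fin n → E3) → ℝ)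
    (v : E3 → ℝ) (m : ℝ) (N : ℕ) : EReal :=
  ⨅ N' : Fin N, groundEnergy S α g Λ I v m N' + groundEnergy S α g Λ I 0 m (N - N')

/-- The negative parts of the potentials are dominated by the kinetic energy: for each `ε > 0`
there is `a(ε)` with `V₋ + I₋ ≤ ε ∑ⱼ pⱼ² + a(ε)` as quadratic forms on the Hilbert space of
`N` particles. -/
def NegPartFormBounded (S : Statistics) (N : ℕ) (v : E3 → ℝ) (I : (Fin N → E3) → ℝ) : Prop :=
  ∀ ε : ℝ, 0 < ε → ∃ a : ℝ, 0 ≤ a ∧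
    ∀ (Φ : Wave N S.spinDim) (G : Fin N → Fin 3 → Wave N S.spinDim),
      IsVector S Φ → IsWeakGradient Φ G →
      weighted (fun _ z =>
          ENNReal.ofReal ((externalPotential N v z.1)⁻ + (I z.1)⁻)) Φ
        ≤ ENNReal.ofReal ε * (∑ j, ∑ i, normSq (G j i)) + ENNReal.ofReal a * normSq Φ

end QED

end

noncomputable section

namespace QED

variable {N d : ℕ}

/-! A positive photon mass only raises the field energy, and a state of finite energy at mass `m`
also has finite energy at mass `0`. Hence all ground state energies, and with them the threshold,
are at least their massless values (`threshold_zero_le`). It remains to see that `E^V(m, N)` exceeds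
`E^V(0, N)` by little for small `m`, which is upper semicontinuity from the right at `m = 0`
(`exists_groundEnergy_lt_add`). One `ε` of the gap `2ε` pays for it.

A nearly optimal massless state may contain infinitely many soft photons on average, and its massive
field energy is then infinite. It is therefore truncated to fewer than `M` photons. On such states
`√(k² + m²) ≤ |k| + m` gives `H_f(m) ≤ H_f(0) + mM` (`fieldEnergy_cut_le`), so at fixed `M` the mass
costs at most `mM`.

The truncation itself must cost little energy as `M → ∞` (`tendsto_realEnergy_cut`). The fields `A`
and `B` change the photon number by one, so the truncation affects each photon number only for
finitely many `M`, and dominated convergence applies. The summable majorant comes from the bounds of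
`a(c)` and `a*(c)` by the massless field energy (`lintegral_annihilate_le`, `lintegral_create_le`).
These rest on the integrability of `|c|²/|k|`, which behaves like `|k|⁻²` near `0` in three
dimensions. -/

/-! ### Cauchy–Schwarz inequalities in `ℝ≥0∞`. -/

/-- Cauchy–Schwarz for lower Lebesgue integrals, squared version. -/
theorem lintegral_sq_le_mul_of_sq_le {β : Type*} [MeasurableSpace β] (μ : Measure β)
    {f a b : β → ℝ≥0∞} (ha : AEMeasurable a μ) (hb : AEMeasurable b μ)
    (h : ∀ x, f x ^ 2 ≤ a x * b x) :
    (∫⁻ x, f x ∂μ) ^ 2 ≤ (∫⁻ x, a x ∂μ) * ∫⁻ x, b x ∂μ := by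
  have half : ∀ t : ℝ≥0∞, (t ^ (1 / 2 : ℝ)) ^ (2 : ℝ) = t := fun t => by
    rw [← ENNReal.rpow_mul]; norm_num
  have hle : ∀ x, f x ≤ a x ^ (1 / 2 : ℝ) * b x ^ (1 / 2 : ℝ) := fun x => by
    rw [← ENNReal.mul_rpow_of_nonneg _ _ (by norm_num : (0 : ℝ) ≤ 1 / 2)]
    rw [one_div, ENNReal.le_rpow_inv_iff (by norm_num : (0 : ℝ) < 2), ENNReal.rpow_ofNat]
    exact h x
  have key := ENNReal.lintegral_mul_le_Lp_mul_Lq μ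
    (Real.holderConjugate_iff.mpr ⟨one_lt_two, by norm_num⟩ : (2 : ℝ).HolderConjugate 2)
    (ha.pow_const (1 / 2 : ℝ)) (hb.pow_const (1 / 2 : ℝ))
  simp only [half, Pi.mul_apply] at key
  calc (∫⁻ x, f x ∂μ) ^ 2
      ≤ ((∫⁻ x, a x ∂μ) ^ (1 / 2 : ℝ) * (∫⁻ x, b x ∂μ) ^ (1 / 2 : ℝ)) ^ (2 : ℝ) := by
        rw [ENNReal.rpow_ofNat]
        exact pow_le_pow_left' ((lintegral_mono hle).trans key) 2
    _ = _ := by rw [ENNReal.mul_rpow_of_nonneg _ _ (by norm_num), half, half]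

/-- Cauchy–Schwarz for finite sums of extended nonnegative numbers, squared version. -/
theorem sum_sq_le_mul_of_sq_le {ι : Type*} [Fintype ι] {f a b : ι → ℝ≥0∞}
    (h : ∀ x, f x ^ 2 ≤ a x * b x) : (∑ x, f x) ^ 2 ≤ (∑ x, a x) * ∑ x, b x := by
  let _ : MeasurableSpace ι := ⊤
  have : ∀ g : ι → ℝ≥0∞, ∑ x, g x = ∫⁻ x, g x ∂Measure.count := fun g => by
    rw [lintegral_count, tsum_fintype]
  rw [this, this, this]
  exact lintegral_sq_le_mul_of_sq_le _ measurable_from_top.aemeasurable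
    measurable_from_top.aemeasurable h

theorem sum_sq_le_card_mul {ι : Type*} [Fintype ι] (f : ι → ℝ≥0∞) :
    (∑ x, f x) ^ 2 ≤ Fintype.card ι * ∑ x, f x ^ 2 := by
  simpa using sum_sq_le_mul_of_sq_le (f := f) (a := fun _ => 1) (b := fun x => f x ^ 2) (by simp)

theorem add_sq_le_two_mul (a b : ℝ≥0∞) : (a + b) ^ 2 ≤ 2 * (a ^ 2 + b ^ 2) := by
  simpa using sum_sq_le_card_mul ![a, b]

theorem enorm_sum_sq_le_card_mul {ι : Type*} [Fintype ι] (f : ι → ℂ) :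
    ‖∑ x, f x‖ₑ ^ 2 ≤ Fintype.card ι * ∑ x, ‖f x‖ₑ ^ 2 :=
  (pow_le_pow_left' (enorm_sum_le _ _) 2).trans (sum_sq_le_card_mul _)

theorem enorm_add_sq_le_two_mul (a b : ℂ) : ‖a + b‖ₑ ^ 2 ≤ 2 * (‖a‖ₑ ^ 2 + ‖b‖ₑ ^ 2) :=
  (pow_le_pow_left' (enorm_add_le _ _) 2).trans (add_sq_le_two_mul _ _)

theorem enorm_ofReal_sqrt_sq {t : ℝ} (ht : 0 ≤ t) :
    ‖((Real.sqrt t : ℝ) : ℂ)‖ₑ ^ 2 = ENNReal.ofReal t := by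
  rw [← ofReal_norm, ← ENNReal.ofReal_pow (norm_nonneg _), Complex.norm_real,
    Real.norm_eq_abs, sq_abs, Real.sq_sqrt ht]

theorem enorm_ofReal_sqrt_natCast_sq (n : ℕ) :
    ‖((Real.sqrt (n + 1) : ℝ) : ℂ)‖ₑ ^ 2 = ((n + 1 : ℕ) : ℝ≥0∞) := by
  rw [enorm_ofReal_sqrt_sq (by positivity), ← ENNReal.ofReal_natCast]; push_cast; rfl

/-! ### Splitting off one photon in integrals and polarization sums. -/

theorem measurable_insertNth {n : ℕ} {β : Type*} [MeasurableSpace β] (r : Fin (n + 1)) :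
    Measurable fun p : β × (Fin n → β) => (r.insertNth p.1 p.2 : Fin (n + 1) → β) :=
  (MeasurableEquiv.piFinSuccAbove (fun _ : Fin (n + 1) => β) r).symm.measurable

/-- Integration over the configurations of one more photon, inserted at the place `r`. -/
theorem lintegral_config_succ {n : ℕ} (r : Fin (n + 1)) {f : Config N (n + 1) → ℝ≥0∞}
    (hf : Measurable f) :
    ∫⁻ z, f z = ∫⁻ z : Config N n, ∫⁻ k : E3,
      f (z.1, (r.insertNth k z.2 : Fin (n + 1) → E3)) := by
  have hins : Measurable fun p : ((Fin N → E3) × (Fin n → E3)) × E3 =>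
      f (p.1.1, (r.insertNth p.2 p.1.2 : Fin (n + 1) → E3)) :=
    hf.comp (measurable_fst.fst.prodMk
      ((measurable_insertNth r).comp (measurable_snd.prodMk measurable_fst.snd)))
  rw [Measure.volume_eq_prod, lintegral_prod _ hf.aemeasurable, Measure.volume_eq_prod,
    lintegral_prod _ hins.lintegral_prod_right'.aemeasurable]
  refine lintegral_congr fun X => ?_
  have hX : Measurable fun K => f (X, K) := hf.comp (measurable_const.prodMk measurable_id)
  rw [← (volume_preserving_piFinSuccAbove (fun _ : Fin (n + 1) => E3) r).symm.lintegral_comp hX,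
    Measure.volume_eq_prod, lintegral_prod_symm]
  · rfl
  · exact (hX.comp (measurable_insertNth r)).aemeasurable

theorem sum_pi_succ {n : ℕ} {β M : Type*} [Fintype β] [AddCommMonoid M] (r : Fin (n + 1))
    (f : (Fin (n + 1) → β) → M) :
    ∑ l, f l = ∑ q : β, ∑ l : Fin n → β, f (r.insertNth q l) := by
  rw [← Fintype.sum_prod_type']
  exact (Fintype.sum_equiv (Fin.insertNthEquiv (fun _ : Fin (n + 1) => β) r) _ _
    fun _ => rfl).symm

theorem omega_zero (k : E3) : omega 0 k = ‖k‖ := by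
  simp [omega]

/-! ### Bounds of creation and annihilation operators by the massless field energy. -/

/-- The form factor `c` is dominated by the infrared weight `‖k‖` times a density `u`. -/
structure IsFormFactor (c : Fin 2 → E3 → E3 → ℂ) (u : E3 → ℝ≥0∞) : Prop where
  measurable : ∀ q, Measurable fun p : E3 × E3 => c q p.1 p.2
  measurable_density : Measurable u
  sq_le : ∀ q k x, ‖c q k x‖ₑ ^ 2 ≤ ‖k‖ₑ * u k
  lintegral_lt_top : ∫⁻ k, u k < ⊤
  lintegral_norm_mul_lt_top : ∫⁻ k, ‖k‖ₑ * u k < ⊤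

variable {c : Fin 2 → E3 → E3 → ℂ} {u : E3 → ℝ≥0∞}

/-- `annihilate` always absorbs the photon in place `0`, whereas the field energy sums over all
places. Bose symmetry under the cycle `r.cycleRange.symm` reconciles the two. -/
theorem photon_symm_insertNth {Φ : Wave N d}
    (hΦs : ∀ (n : ℕ) (τ : Equiv.Perm (Fin n)) s l X K, Φ n s (l ∘ τ) (X, K ∘ τ) = Φ n s l (X, K))
    {n : ℕ} (r : Fin (n + 1)) (s : Fin N → Fin d) (q : Fin 2) (l : Fin n → Fin 2)
    (X : Fin N → E3) (k : E3) (K : Fin n → E3) :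
    Φ (n + 1) s (Fin.cons q l : Fin (n + 1) → Fin 2) (X, (Fin.cons k K : Fin (n + 1) → E3))
      = Φ (n + 1) s (r.insertNth q l) (X, r.insertNth k K) := by
  rw [← hΦs (n + 1) r.cycleRange.symm s (r.insertNth q l) X (r.insertNth k K)]
  rw [Fin.insertNth_comp_cycleRange_symm, Fin.insertNth_comp_cycleRange_symm]

/-- `‖a(c) Φ‖² ≤ const (Φ, H_f Φ)`, one photon number and spin at a time. -/
theorem lintegral_annihilate_le (hc : IsFormFactor c u) (j : Fin N) {Φ : Wave N d}
    (hΦ : ∀ n s l, Measurable (Φ n s l))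
    (hΦs : ∀ (n : ℕ) (τ : Equiv.Perm (Fin n)) s l X K, Φ n s (l ∘ τ) (X, K ∘ τ) = Φ n s l (X, K))
    (n : ℕ) (s : Fin N → Fin d) :
    ∑ l : Fin n → Fin 2, ∫⁻ z, ‖annihilate c j Φ n s l z‖ₑ ^ 2
      ≤ 2 * (∫⁻ k, u k) * ∑ l : Fin (n + 1) → Fin 2, ∫⁻ z : Config N (n + 1),
        (∑ r, ENNReal.ofReal (omega 0 (z.2 r))) * ‖Φ (n + 1) s l z‖ₑ ^ 2 := by
  set U := ∫⁻ k, u k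
  let cons' (z : Config N n) (k : E3) : Config N (n + 1) :=
    (z.1, (Fin.cons k z.2 : Fin (n + 1) → E3))
  have hcons : Measurable fun p : Config N n × E3 => cons' p.1 p.2 := by
    have h : Measurable fun p : Config N n × E3 => (p.2, p.1.2) :=
      measurable_snd.prodMk measurable_fst.snd
    have h' := (measurable_insertNth (β := E3) (0 : Fin (n + 1))).comp h
    simp only [Function.comp_def, Fin.insertNth_zero'] at h'
    exact measurable_fst.fst.prodMk h'
  -- Cauchy–Schwarz in `k` with `|c|² ≤ u · ‖k‖`: the density `u` is integrated alone and `‖k‖`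
  -- stays with the wave function as photon energy. The factor 2 is the number of polarizations.
  have pointwise : ∀ l z, ‖annihilate c j Φ n s l z‖ₑ ^ 2 ≤ ((n + 1 : ℕ) : ℝ≥0∞) * (2 *
      ∑ q : Fin 2, U * ∫⁻ k, ‖k‖ₑ * ‖Φ (n + 1) s (Fin.cons q l : Fin (n + 1) → Fin 2)
        (cons' z k)‖ₑ ^ 2) := by
    intro l z
    rw [annihilate, enorm_mul, mul_pow, enorm_ofReal_sqrt_natCast_sq]
    gcongr
    refine (enorm_sum_sq_le_card_mul _).trans ?_
    rw [Fintype.card_fin]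
    norm_num only [Nat.cast_ofNat]
    gcongr with q
    refine (pow_le_pow_left' (enorm_integral_le_lintegral_enorm _) 2).trans ?_
    refine lintegral_sq_le_mul_of_sq_le _ hc.measurable_density.aemeasurable ?_ fun k => ?_
    · refine (measurable_enorm.mul (((hΦ _ _ _).comp
        (hcons.comp (measurable_const.prodMk measurable_id))).enorm.pow_const 2)).aemeasurable
    · rw [enorm_mul, mul_pow, ← mul_assoc, mul_comm (u k)]
      gcongr
      exact hc.sq_le q k _
  have single : ∀ r : Fin (n + 1), ∑ l : Fin (n + 1) → Fin 2, ∫⁻ z : Config N (n + 1),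
        ENNReal.ofReal (omega 0 (z.2 r)) * ‖Φ (n + 1) s l z‖ₑ ^ 2
      = ∑ l : Fin n → Fin 2, ∑ q : Fin 2, ∫⁻ z, ∫⁻ k, ‖k‖ₑ *
        ‖Φ (n + 1) s (Fin.cons q l : Fin (n + 1) → Fin 2) (cons' z k)‖ₑ ^ 2 := by
    intro r
    rw [sum_pi_succ r, Finset.sum_comm]
    refine Finset.sum_congr rfl fun l _ => Finset.sum_congr rfl fun q _ => ?_
    simp only [omega_zero, ofReal_norm]
    rw [lintegral_config_succ r]
    · refine lintegral_congr fun z => lintegral_congr fun k => ?_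
      rw [photon_symm_insertNth hΦs r]
      simp
    · exact ((measurable_pi_apply r).comp measurable_snd).enorm.mul ((hΦ _ _ _).enorm.pow_const 2)
  -- All `n + 1` photons carry the same mean energy, which absorbs the square of the normalization
  -- factor `√(n + 1)`.
  have total : ∑ l : Fin (n + 1) → Fin 2, ∫⁻ z : Config N (n + 1),
        (∑ r, ENNReal.ofReal (omega 0 (z.2 r))) * ‖Φ (n + 1) s l z‖ₑ ^ 2
      = ((n + 1 : ℕ) : ℝ≥0∞) * ∑ l : Fin n → Fin 2, ∑ q : Fin 2, ∫⁻ z, ∫⁻ k, ‖k‖ₑ *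
        ‖Φ (n + 1) s (Fin.cons q l : Fin (n + 1) → Fin 2) (cons' z k)‖ₑ ^ 2 := by
    simp only [Finset.sum_mul]
    have : ∀ l : Fin (n + 1) → Fin 2, ∫⁻ z : Config N (n + 1),
        ∑ r, ENNReal.ofReal (omega 0 (z.2 r)) * ‖Φ (n + 1) s l z‖ₑ ^ 2
        = ∑ r, ∫⁻ z : Config N (n + 1),
          ENNReal.ofReal (omega 0 (z.2 r)) * ‖Φ (n + 1) s l z‖ₑ ^ 2 := fun l => by
      refine lintegral_finsetSum _ fun r _ => ?_
      simp only [omega_zero, ofReal_norm]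
      exact ((measurable_pi_apply r).comp measurable_snd).enorm.mul ((hΦ _ _ _).enorm.pow_const 2)
    simp only [this]
    rw [Finset.sum_comm]
    simp only [single]
    simp
  have hm : ∀ (l : Fin n → Fin 2) (q : Fin 2), Measurable fun z : Config N n =>
      ∫⁻ k, ‖k‖ₑ * ‖Φ (n + 1) s (Fin.cons q l : Fin (n + 1) → Fin 2) (cons' z k)‖ₑ ^ 2 := by
    intro l q
    have h : Measurable fun p : Config N n × E3 => ‖p.2‖ₑ *
        ‖Φ (n + 1) s (Fin.cons q l : Fin (n + 1) → Fin 2) (cons' p.1 p.2)‖ₑ ^ 2 :=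
      measurable_snd.enorm.mul (((hΦ _ _ _).comp hcons).enorm.pow_const 2)
    exact h.lintegral_prod_right'
  rw [total]
  calc _ ≤ ∑ l : Fin n → Fin 2, ∫⁻ z, ((n + 1 : ℕ) : ℝ≥0∞) * (2 * ∑ q : Fin 2, U *
          ∫⁻ k, ‖k‖ₑ * ‖Φ (n + 1) s (Fin.cons q l : Fin (n + 1) → Fin 2) (cons' z k)‖ₑ ^ 2) :=
        Finset.sum_le_sum fun l _ => lintegral_mono (pointwise l)
    _ = ∑ l : Fin n → Fin 2, ((n + 1 : ℕ) : ℝ≥0∞) * (2 * ∑ q : Fin 2, U * ∫⁻ z,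
          ∫⁻ k, ‖k‖ₑ * ‖Φ (n + 1) s (Fin.cons q l : Fin (n + 1) → Fin 2) (cons' z k)‖ₑ ^ 2) := by
        refine Finset.sum_congr rfl fun l _ => ?_
        rw [lintegral_const_mul, lintegral_const_mul, lintegral_finsetSum]
        · simp only [lintegral_const_mul _ (hm l _)]
        · exact fun q _ => (hm l q).const_mul _
        · exact Finset.measurable_fun_sum _ fun q _ => (hm l q).const_mul _
        · exact (Finset.measurable_fun_sum _ fun q _ => (hm l q).const_mul _).const_mul _
    _ = _ := by
        simp only [← Finset.mul_sum]
        ring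

/-- `‖a*(c) Φ‖² ≤ const (Φ, (H_f + 1) Φ)`, one photon number and spin at a time. -/
theorem lintegral_create_le (hc : IsFormFactor c u) (j : Fin N) {Φ : Wave N d}
    (hΦ : ∀ n s l, Measurable (Φ n s l)) (n : ℕ) (s : Fin N → Fin d) :
    ∑ l : Fin (n + 1) → Fin 2, ∫⁻ z, ‖create c j Φ (n + 1) s l z‖ₑ ^ 2
      ≤ 2 * ((∫⁻ k, ‖k‖ₑ * u k) * (∑ l : Fin n → Fin 2, ∫⁻ z, ‖Φ n s l z‖ₑ ^ 2) +
        (∫⁻ k, u k) * ∑ l : Fin n → Fin 2, ∫⁻ z : Config N n,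
        (∑ r, ENNReal.ofReal (omega 0 (z.2 r))) * ‖Φ n s l z‖ₑ ^ 2) := by
  have hu := hc.measurable_density
  set U := ∫⁻ k, u k
  set U₁ := ∫⁻ k, ‖k‖ₑ * u k
  have hn0 : ((n + 1 : ℕ) : ℝ≥0∞) ≠ 0 := by simp
  have hnt : ((n + 1 : ℕ) : ℝ≥0∞) ≠ ⊤ := ENNReal.natCast_ne_top _
  have hH : ∀ n, Measurable fun z : Config N n => ∑ r, ‖z.2 r‖ₑ := fun n =>
    Finset.measurable_fun_sum _ fun r _ => ((measurable_pi_apply r).comp measurable_snd).enorm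
  have hrem : ∀ r : Fin (n + 1), Measurable fun z : Config N (n + 1) =>
      ((z.1, r.removeNth z.2) : Config N n) := fun r =>
    measurable_fst.prodMk (measurable_pi_iff.2 fun i =>
      (measurable_pi_apply (r.succAbove i)).comp measurable_snd)
  let T (r : Fin (n + 1)) (l : Fin (n + 1) → Fin 2) (z : Config N (n + 1)) : ℝ≥0∞ :=
    u (z.2 r) * ‖Φ n s (r.removeNth l) (z.1, r.removeNth z.2)‖ₑ ^ 2
  have hT : ∀ r l, Measurable (T r l) := fun r l =>
    (hu.comp ((measurable_pi_apply r).comp measurable_snd)).mul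
      (((hΦ _ _ _).comp (hrem r)).enorm.pow_const 2)
  -- Cauchy–Schwarz over the created photon `r`, with weights `‖k_r‖` and `u(k_r) |Φ|²`. It avoids
  -- the factor `n + 1` that a plain count of the summands would cost.
  have pointwise : ∀ l z, ‖create c j Φ (n + 1) s l z‖ₑ ^ 2 ≤
      ((n + 1 : ℕ) : ℝ≥0∞)⁻¹ * ∑ r, (∑ r', ‖z.2 r'‖ₑ) * T r l z := by
    intro l z
    rw [create, enorm_mul, mul_pow, ← Finset.mul_sum]
    have : ‖(((Real.sqrt (n + 1))⁻¹ : ℝ) : ℂ)‖ₑ ^ 2 = ((n + 1 : ℕ) : ℝ≥0∞)⁻¹ := by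
      rw [Complex.ofReal_inv, enorm_inv, ← ENNReal.inv_pow, enorm_ofReal_sqrt_natCast_sq]
      exact_mod_cast (Real.sqrt_pos.2 (by positivity)).ne'
    rw [this]
    gcongr
    refine (pow_le_pow_left' (enorm_sum_le _ _) 2).trans (sum_sq_le_mul_of_sq_le fun r => ?_)
    rw [enorm_mul, mul_pow, RCLike.enorm_conj, ← mul_assoc]
    gcongr
    exact hc.sq_le _ _ _
  -- The energy of the created photon itself yields `U₁` times the norm, that of the other photons
  -- yields `U` times the field energy. The value does not depend on `r`, so the `n + 1` terms
  -- cancel the prefactor `1/(n + 1)`.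
  have term : ∀ r : Fin (n + 1), ∑ l, ∫⁻ z, (∑ r', ‖z.2 r'‖ₑ) * T r l z =
      2 * (U₁ * (∑ l : Fin n → Fin 2, ∫⁻ z, ‖Φ n s l z‖ₑ ^ 2) +
        U * ∑ l : Fin n → Fin 2, ∫⁻ z : Config N n, (∑ r, ‖z.2 r‖ₑ) * ‖Φ n s l z‖ₑ ^ 2) := by
    intro r
    rw [sum_pi_succ r]
    have inner : ∀ (q : Fin 2) (l : Fin n → Fin 2),
        ∫⁻ z, (∑ r', ‖z.2 r'‖ₑ) * T r (r.insertNth q l) z =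
        U₁ * (∫⁻ z, ‖Φ n s l z‖ₑ ^ 2) +
          U * ∫⁻ z : Config N n, (∑ r, ‖z.2 r‖ₑ) * ‖Φ n s l z‖ₑ ^ 2 := by
      intro q l
      rw [lintegral_config_succ r (f := fun z => (∑ r', ‖z.2 r'‖ₑ) * T r (r.insertNth q l) z)
          ((hH _).mul (hT r _)),
        ← lintegral_const_mul U₁ ((hΦ _ _ _).enorm.pow_const 2),
        ← lintegral_const_mul U (f := fun z : Config N n => (∑ r, ‖z.2 r‖ₑ) * ‖Φ n s l z‖ₑ ^ 2)
          ((hH n).mul ((hΦ _ _ _).enorm.pow_const 2)),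
        ← lintegral_add_left (((hΦ _ _ _).enorm.pow_const 2).const_mul _)]
      refine lintegral_congr fun z => ?_
      rw [← mul_assoc, ← add_mul, ← lintegral_mul_const _ hu,
        ← lintegral_add_left (f := fun k : E3 => ‖k‖ₑ * u k) (measurable_enorm.mul hu),
        ← lintegral_mul_const _ (f := fun k : E3 => ‖k‖ₑ * u k + u k * ∑ r, ‖z.2 r‖ₑ)
          ((measurable_enorm.mul hu).add (hu.mul_const _))]
      refine lintegral_congr fun k => ?_
      simp only [T, Fin.sum_univ_succAbove _ r, Fin.insertNth_apply_same,
        Fin.insertNth_apply_succAbove, Fin.removeNth_insertNth]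
      ring
    simp only [inner, Finset.sum_add_distrib, ← Finset.mul_sum]
    simp only [Finset.sum_const, Finset.card_univ, Fintype.card_fin, nsmul_eq_mul, Nat.cast_ofNat]
    ring
  simp only [omega_zero, ofReal_norm]
  calc _ ≤ ∑ l, ∫⁻ z, ((n + 1 : ℕ) : ℝ≥0∞)⁻¹ * ∑ r, (∑ r', ‖z.2 r'‖ₑ) * T r l z :=
        Finset.sum_le_sum fun l _ => lintegral_mono (pointwise l)
    _ = ((n + 1 : ℕ) : ℝ≥0∞)⁻¹ * ∑ r, ∑ l, ∫⁻ z, (∑ r', ‖z.2 r'‖ₑ) * T r l z := by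
        rw [Finset.sum_comm, Finset.mul_sum]
        refine Finset.sum_congr rfl fun l _ => ?_
        rw [lintegral_const_mul, lintegral_finsetSum]
        · exact fun r _ => (hH _).mul (hT r l)
        · exact Finset.measurable_fun_sum _ fun r _ => (hH _).mul (hT r l)
    _ = _ := by
        simp only [term]
        rw [Finset.sum_const, Finset.card_univ, Fintype.card_fin, nsmul_eq_mul, ← mul_assoc,
          ENNReal.inv_mul_cancel hn0 hnt, one_mul]

theorem normSq_annihilate_lt_top (hc : IsFormFactor c u) (j : Fin N) {Φ : Wave N d}
    (hΦ : ∀ n s l, Measurable (Φ n s l))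
    (hΦs : ∀ (n : ℕ) (τ : Equiv.Perm (Fin n)) s l X K, Φ n s (l ∘ τ) (X, K ∘ τ) = Φ n s l (X, K))
    (hE : fieldEnergy 0 Φ < ⊤) : normSq (annihilate c j Φ) < ⊤ := by
  refine lt_of_le_of_lt (b := 2 * (∫⁻ k, u k) * fieldEnergy 0 Φ) ?_
    (ENNReal.mul_lt_top (ENNReal.mul_lt_top (by simp) hc.lintegral_lt_top) hE)
  simp only [normSq, weighted, fieldEnergy, one_mul]
  -- Level `n` of `annihilate c j Φ` is controlled by level `n + 1` of `Φ`; the vacuum term on the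
  -- right is discarded.
  rw [tsum_eq_zero_add' (f := fun n => ∑ s : Fin N → Fin d, ∑ l : Fin n → Fin 2,
    ∫⁻ z : Config N n, (∑ r, ENNReal.ofReal (omega 0 (z.2 r))) * ‖Φ n s l z‖ₑ ^ 2)
    ENNReal.summable, mul_add]
  refine le_add_left ?_
  rw [← ENNReal.tsum_mul_left]
  refine ENNReal.tsum_le_tsum fun n => ?_
  rw [Finset.mul_sum]
  exact Finset.sum_le_sum fun s _ => lintegral_annihilate_le hc j hΦ hΦs n s

theorem normSq_create_lt_top (hc : IsFormFactor c u) (j : Fin N) {Φ : Wave N d}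
    (hΦ : ∀ n s l, Measurable (Φ n s l)) (hn : normSq Φ < ⊤)
    (hE : fieldEnergy 0 Φ < ⊤) : normSq (create c j Φ) < ⊤ := by
  refine lt_of_le_of_lt
    (b := 2 * ((∫⁻ k, ‖k‖ₑ * u k) * normSq Φ + (∫⁻ k, u k) * fieldEnergy 0 Φ)) ?_
    (ENNReal.mul_lt_top (by simp) (ENNReal.add_lt_top.2
      ⟨ENNReal.mul_lt_top hc.lintegral_norm_mul_lt_top hn,
        ENNReal.mul_lt_top hc.lintegral_lt_top hE⟩))
  simp only [normSq, weighted, fieldEnergy, one_mul]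
  rw [tsum_eq_zero_add' ENNReal.summable]
  simp only [create, enorm_zero, ne_eq, OfNat.ofNat_ne_zero, not_false_eq_true, zero_pow,
    lintegral_zero, Finset.sum_const_zero, zero_add]
  rw [← ENNReal.tsum_mul_left, ← ENNReal.tsum_mul_left, ← ENNReal.tsum_add,
    ← ENNReal.tsum_mul_left]
  refine ENNReal.tsum_le_tsum fun n => ?_
  rw [Finset.mul_sum, Finset.mul_sum, ← Finset.sum_add_distrib, Finset.mul_sum]
  exact Finset.sum_le_sum fun s _ => lintegral_create_le hc j hΦ n s

theorem measurable_create (hc : ∀ q, Measurable fun p : E3 × E3 => c q p.1 p.2) (j : Fin N)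
    {Φ : Wave N d} (hΦ : ∀ n s l, Measurable (Φ n s l)) (n : ℕ) (s : Fin N → Fin d)
    (l : Fin n → Fin 2) : Measurable (create c j Φ n s l) := by
  cases n with
  | zero => exact measurable_const
  | succ n =>
    refine (Finset.measurable_fun_sum _ fun r _ => ?_).const_mul _
    have h : Measurable fun z : Config N (n + 1) => (z.2 r, z.1 j) :=
      ((measurable_pi_apply r).comp measurable_snd).prodMk
        ((measurable_pi_apply j).comp measurable_fst)
    refine (Complex.continuous_conj.measurable.comp ((hc (l r)).comp h)).mul ((hΦ _ _ _).comp ?_)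
    exact measurable_fst.prodMk (measurable_pi_iff.2 fun i =>
      (measurable_pi_apply (r.succAbove i)).comp measurable_snd)

/-! ### The form factors of `A` and `B`. -/

/-- `C |k|⁻²` inside the ball of radius `Λ`. -/
def infraredDensity (C Λ : ℝ) (k : E3) : ℝ≥0∞ :=
  (Metric.ball (0 : E3) Λ).indicator (fun k => ENNReal.ofReal (C * (‖k‖ ^ 2)⁻¹)) k

theorem measurable_infraredDensity (C Λ : ℝ) : Measurable (infraredDensity C Λ) :=
  Measurable.indicator (by fun_prop) measurableSet_ball

/-- The singularity `|k|⁻²` is integrable at the origin because the exponent 2 is below the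
dimension 3. -/
theorem lintegral_infraredDensity_lt_top (C Λ : ℝ) : ∫⁻ k, infraredDensity C Λ k < ⊤ := by
  have hi : IntegrableOn (fun k : E3 => C * (‖k‖ ^ 2)⁻¹) (Metric.ball 0 Λ) := by
    have h : IntegrableOn (fun k : E3 => (‖k‖ ^ 2)⁻¹) (Metric.ball 0 Λ) volume := by
      refine integrableOn_ball_of_norm_le_rpow (α := 2) ?_ ?_ (C := 1) ?_ ?_
      · simp
      · simp; norm_num
      · refine Filter.Eventually.of_forall fun k => ?_
        rw [Real.rpow_neg (norm_nonneg _), one_mul, Real.rpow_ofNat, norm_inv, norm_pow, norm_norm]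
      · exact (by fun_prop : Measurable fun k : E3 => (‖k‖ ^ 2)⁻¹).aestronglyMeasurable
    exact Integrable.const_mul h C
  unfold infraredDensity
  rw [lintegral_indicator measurableSet_ball]
  exact hi.lintegral_lt_top

theorem lintegral_norm_mul_infraredDensity_lt_top (C Λ : ℝ) :
    ∫⁻ k, ‖k‖ₑ * infraredDensity C Λ k < ⊤ := by
  refine lt_of_le_of_lt (b := ENNReal.ofReal Λ * ∫⁻ k, infraredDensity C Λ k) ?_
    (ENNReal.mul_lt_top ENNReal.ofReal_lt_top (lintegral_infraredDensity_lt_top C Λ))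
  rw [← lintegral_const_mul _ (measurable_infraredDensity C Λ)]
  refine lintegral_mono fun k => ?_
  by_cases hk : k ∈ Metric.ball (0 : E3) Λ
  · gcongr
    rw [← ofReal_norm]
    exact ENNReal.ofReal_le_ofReal (mem_ball_zero_iff.1 hk).le
  · simp [infraredDensity, hk]

theorem measurable_cutoffWave (Λ : ℝ) : Measurable fun p : E3 × E3 => cutoffWave Λ p.1 p.2 := by
  unfold cutoffWave
  refine Measurable.ite (measurableSet_lt (by fun_prop) (by fun_prop)) ?_ measurable_const
  refine Measurable.mul (by fun_prop) ?_
  have h : Continuous fun p : E3 × E3 =>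
      Complex.exp (Complex.I * ((inner ℝ p.1 p.2 : ℝ) : ℂ)) := by fun_prop
  exact h.measurable

theorem isFormFactor_mul_cutoffWave {Λ B : ℝ} {w : Fin 2 → E3 → ℂ}
    (hw : ∀ q, Measurable (w q)) (hB : ∀ q k, ‖k‖ < Λ → ‖w q k‖ ≤ B) :
    IsFormFactor (fun q k x => w q k * cutoffWave Λ k x) (infraredDensity (B ^ 2) Λ) where
  measurable q := ((hw q).comp measurable_fst).mul (measurable_cutoffWave Λ)
  measurable_density := measurable_infraredDensity _ _
  sq_le q k x := by
    by_cases hk : ‖k‖ < Λ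
    · have hball : k ∈ Metric.ball (0 : E3) Λ := mem_ball_zero_iff.2 hk
      rw [infraredDensity, Set.indicator_of_mem hball, ← ofReal_norm, ← ofReal_norm,
        ← ENNReal.ofReal_pow (norm_nonneg _), ← ENNReal.ofReal_mul (norm_nonneg _)]
      refine ENNReal.ofReal_le_ofReal ?_
      have hexp : ‖Complex.exp (Complex.I * ((inner ℝ k x : ℝ) : ℂ))‖ = 1 := by
        rw [mul_comm, Complex.norm_exp_ofReal_mul_I]
      rw [cutoffWave, if_pos hk, norm_mul, norm_mul, hexp, mul_one, Complex.norm_real, mul_pow,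
        Real.norm_eq_abs, sq_abs, inv_pow, Real.sq_sqrt (norm_nonneg k)]
      have h1 : ‖w q k‖ ^ 2 ≤ B ^ 2 := pow_le_pow_left₀ (norm_nonneg _) (hB q k hk) 2
      have h2 : ‖k‖⁻¹ = ‖k‖ * (‖k‖ ^ 2)⁻¹ := by
        -- At `k = 0` both sides vanish, since the inverse of zero is zero.
        rcases eq_or_ne ‖k‖ 0 with h | h
        · simp [h]
        · field_simp
      calc ‖w q k‖ ^ 2 * ‖k‖⁻¹ ≤ B ^ 2 * ‖k‖⁻¹ := by gcongr
        _ = _ := by rw [h2]; ring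
    · simp [cutoffWave, hk]
  lintegral_lt_top := lintegral_infraredDensity_lt_top _ _
  lintegral_norm_mul_lt_top := lintegral_norm_mul_infraredDensity_lt_top _ _

theorem abs_crossProduct_apply_le {a b : Fin 3 → ℝ} {A B : ℝ} (ha : ∀ i, |a i| ≤ A)
    (hb : ∀ i, |b i| ≤ B) (i : Fin 3) : |crossProduct a b i| ≤ 2 * (A * B) := by
  have hA : 0 ≤ A := (abs_nonneg _).trans (ha 0)
  have h : ∀ p q r t : Fin 3, |a p * b q - a r * b t| ≤ 2 * (A * B) := fun p q r t => by
    refine (abs_sub _ _).trans ?_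
    rw [abs_mul, abs_mul, two_mul]
    exact add_le_add (mul_le_mul (ha p) (hb q) (abs_nonneg _) hA)
      (mul_le_mul (ha r) (hb t) (abs_nonneg _) hA)
  rw [cross_apply]
  fin_cases i <;> exact h _ _ _ _

theorem abs_coord_le_norm (k : E3) (i : Fin 3) : |k i| ≤ ‖k‖ :=
  PiLp.norm_apply_le k i

/-- Only boundedness matters: the 2 is the crude bound for the two terms of a cross product. On the
third axis, where the formula for `ε₁` divides by zero, the vectors are zero. -/
theorem abs_polarization_le (l : Fin 2) (k : E3) (i : Fin 3) : |polarization l k i| ≤ 2 := by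
  have he : ∀ i, |((Real.sqrt (k 0 ^ 2 + k 1 ^ 2))⁻¹ • ![k 1, -k 0, 0] : Fin 3 → ℝ) i| ≤ 1 := by
    intro i
    rw [Pi.smul_apply, smul_eq_mul, abs_mul, abs_inv, abs_of_nonneg (Real.sqrt_nonneg _),
      inv_mul_eq_div]
    refine div_le_one_of_le₀ ?_ (Real.sqrt_nonneg _)
    refine Real.abs_le_sqrt ?_
    fin_cases i
    · simp [sq_nonneg]
    · simp [sq_nonneg]
    · simp; positivity
  have hk : ∀ i, |(‖k‖⁻¹ • (fun i => k i) : Fin 3 → ℝ) i| ≤ 1 := by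
    intro i
    rw [Pi.smul_apply, smul_eq_mul, abs_mul, abs_inv, abs_norm, inv_mul_eq_div]
    exact div_le_one_of_le₀ (abs_coord_le_norm k i) (norm_nonneg _)
  unfold polarization
  split_ifs
  · exact (he i).trans one_le_two
  · simpa using abs_crossProduct_apply_le hk he i

theorem measurable_coord (i : Fin 3) : Measurable fun k : E3 => k i := by fun_prop

theorem measurable_crossProduct {a b : E3 → Fin 3 → ℝ} (ha : ∀ i, Measurable fun k => a k i)
    (hb : ∀ i, Measurable fun k => b k i) (i : Fin 3) :
    Measurable fun k => crossProduct (a k) (b k) i := by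
  simp only [cross_apply]
  fin_cases i <;> exact ((ha _).mul (hb _)).sub ((ha _).mul (hb _))

theorem measurable_polarization (l : Fin 2) (i : Fin 3) :
    Measurable fun k => polarization l k i := by
  have he : ∀ i, Measurable fun k : E3 =>
      ((Real.sqrt (k 0 ^ 2 + k 1 ^ 2))⁻¹ • ![k 1, -k 0, 0] : Fin 3 → ℝ) i := by
    intro i
    refine Measurable.mul (by fun_prop) ?_
    fin_cases i
    · exact measurable_coord 1
    · exact (measurable_coord 0).neg
    · exact measurable_const
  unfold polarization
  by_cases hl : l = 0
  · simpa only [hl, if_true] using he i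
  · simp only [hl, if_false]
    exact measurable_crossProduct (fun i => Measurable.mul (by fun_prop) (measurable_coord i)) he i

theorem isFormFactor_aCoeff (Λ : ℝ) (i : Fin 3) :
    IsFormFactor (aCoeff Λ i) (infraredDensity (2 ^ 2) Λ) := by
  refine isFormFactor_mul_cutoffWave (w := fun q k => (polarization q k i : ℂ))
    (fun q => Complex.measurable_ofReal.comp (measurable_polarization q i)) fun q k _ => ?_
  rw [Complex.norm_real]
  exact abs_polarization_le q k i

theorem isFormFactor_bCoeff (Λ : ℝ) (i : Fin 3) :
    IsFormFactor (bCoeff Λ i) (infraredDensity ((2 * (Λ * 2)) ^ 2) Λ) := by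
  refine isFormFactor_mul_cutoffWave
    (w := fun q k => Complex.I * ((crossProduct (fun i => k i) (polarization q k) i : ℝ) : ℂ))
    (fun q => (Complex.measurable_ofReal.comp (measurable_crossProduct measurable_coord
      (measurable_polarization q) i)).const_mul _) fun q k hk => ?_
  rw [norm_mul, Complex.norm_I, one_mul, Complex.norm_real]
  exact abs_crossProduct_apply_le (fun i => (abs_coord_le_norm k i).trans hk.le)
    (abs_polarization_le q k) i

/-! ### Decomposition by photon number and multiplication by functions of it. -/

/-- The amplitudes with a fixed number `n` of photons. -/
abbrev Level (N d n : ℕ) : Type :=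
  (Fin N → Fin d) → (Fin n → Fin 2) → Config N n → ℂ

/-- The contribution of the amplitudes with `n` photons to `weighted`. -/
def levelWeighted {n : ℕ} (w : Config N n → ℝ≥0∞) (F : Level N d n) : ℝ≥0∞ :=
  ∑ s, ∑ l, ∫⁻ z, w z * ‖F s l z‖ₑ ^ 2

/-- The squared norm of the amplitudes with `n` photons. -/
def levelSq {n : ℕ} (F : Level N d n) : ℝ≥0∞ := levelWeighted (fun _ => 1) F

theorem weighted_eq_tsum (w : (n : ℕ) → Config N n → ℝ≥0∞) (Φ : Wave N d) :
    weighted w Φ = ∑' n, levelWeighted (w n) (Φ n) := rfl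

theorem normSq_eq_tsum (Φ : Wave N d) : normSq Φ = ∑' n, levelSq (Φ n) := rfl

theorem levelWeighted_smul {n : ℕ} (w : Config N n → ℝ≥0∞) (a : ℂ) (F : Level N d n) :
    levelWeighted w (a • F) = ‖a‖ₑ ^ 2 * levelWeighted w F := by
  simp only [levelWeighted, Finset.mul_sum]
  refine Finset.sum_congr rfl fun s _ => Finset.sum_congr rfl fun l _ => ?_
  rw [← lintegral_const_mul' _ _ (by simp)]
  refine lintegral_congr fun z => ?_
  simp only [Pi.smul_apply, smul_eq_mul, enorm_mul, mul_pow]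
  ring

theorem levelSq_smul {n : ℕ} (a : ℂ) (F : Level N d n) :
    levelSq (a • F) = ‖a‖ₑ ^ 2 * levelSq F := levelWeighted_smul _ a F

theorem levelSq_add_le {n : ℕ} {F : Level N d n} (hF : ∀ s l, Measurable (F s l))
    (F' : Level N d n) : levelSq (F + F') ≤ 2 * (levelSq F + levelSq F') := by
  simp only [levelSq, levelWeighted, one_mul, ← Finset.sum_add_distrib, Finset.mul_sum]
  refine Finset.sum_le_sum fun s _ => Finset.sum_le_sum fun l _ => ?_
  rw [← lintegral_add_left ((hF s l).enorm.pow_const 2), ← lintegral_const_mul' _ _ (by simp)]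
  exact lintegral_mono fun z => enorm_add_sq_le_two_mul _ _

/-- Multiplication of the amplitudes with `n` photons by `b n`. -/
def levelMul (b : ℕ → ℂ) (Φ : Wave N d) : Wave N d := fun n => b n • Φ n

theorem levelMul_apply (b : ℕ → ℂ) (Φ : Wave N d) (n s l z) :
    levelMul b Φ n s l z = b n * Φ n s l z := rfl

theorem annihilate_levelMul (c : Fin 2 → E3 → E3 → ℂ) (j : Fin N) (b : ℕ → ℂ) (Φ : Wave N d)
    (n : ℕ) : annihilate c j (levelMul b Φ) n = b (n + 1) • annihilate c j Φ n := by
  funext s l z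
  simp only [annihilate, levelMul_apply, Pi.smul_apply, smul_eq_mul, mul_left_comm _ (b (n + 1)),
    integral_const_mul, ← Finset.mul_sum]

theorem create_levelMul_succ (c : Fin 2 → E3 → E3 → ℂ) (j : Fin N) (b : ℕ → ℂ) (Φ : Wave N d)
    (n : ℕ) : create c j (levelMul b Φ) (n + 1) = b n • create c j Φ (n + 1) := by
  funext s l z
  simp only [create, levelMul_apply, Pi.smul_apply, smul_eq_mul, mul_left_comm _ (b n),
    ← Finset.mul_sum]

theorem create_levelMul (c : Fin 2 → E3 → E3 → ℂ) (j : Fin N) (b : ℕ → ℂ) (Φ : Wave N d)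
    (n : ℕ) : create c j (levelMul b Φ) n = b (n - 1) • create c j Φ n := by
  cases n with
  -- At `n = 0` the index `n - 1` is truncated to `0`; this is harmless because `create` has no
  -- vacuum component.
  | zero => funext s l z; simp [create]
  | succ n => exact create_levelMul_succ c j b Φ n

/-- The two parts of the field receive different factors, so a photon-number cutoff does not commute
with it, but only the neighbouring levels `n ± 1` enter. -/
theorem field_levelMul (c : Fin 2 → E3 → E3 → ℂ) (j : Fin N) (b : ℕ → ℂ) (Φ : Wave N d)
    (n : ℕ) : field c j (levelMul b Φ) n
      = b (n + 1) • annihilate c j Φ n + b (n - 1) • create c j Φ n := by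
  rw [← annihilate_levelMul, ← create_levelMul]
  rfl

theorem field_levelMul_const (c : Fin 2 → E3 → E3 → ℂ) (j : Fin N) (a : ℂ) (Φ : Wave N d) :
    field c j (levelMul (fun _ => a) Φ) = levelMul (fun _ => a) (field c j Φ) := by
  funext n
  rw [field_levelMul, ← smul_add]
  rfl

theorem spinOp_levelMul (S : Statistics) (j : Fin N) (i : Fin 3) (b : ℕ → ℂ)
    (Φ : Wave N S.spinDim) : spinOp S j i (levelMul b Φ) = levelMul b (spinOp S j i Φ) := by
  funext n s l z
  simp only [spinOp, levelMul_apply, Finset.mul_sum, mul_left_comm _ (b n)]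

theorem weighted_levelMul_le {b : ℕ → ℂ} {B : ℝ≥0∞} (hb : ∀ n, ‖b n‖ₑ ^ 2 ≤ B)
    (w : (n : ℕ) → Config N n → ℝ≥0∞) (Φ : Wave N d) :
    weighted w (levelMul b Φ) ≤ B * weighted w Φ := by
  rw [weighted_eq_tsum, weighted_eq_tsum, ← ENNReal.tsum_mul_left]
  refine ENNReal.tsum_le_tsum fun n => ?_
  rw [levelMul, levelWeighted_smul]
  gcongr
  exact hb n

theorem weighted_levelMul_const (a : ℂ) (w : (n : ℕ) → Config N n → ℝ≥0∞) (Φ : Wave N d) :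
    weighted w (levelMul (fun _ => a) Φ) = ‖a‖ₑ ^ 2 * weighted w Φ := by
  simp only [weighted_eq_tsum, levelMul, levelWeighted_smul, ENNReal.tsum_mul_left]

theorem IsVector.levelMul {S : Statistics} {Φ : Wave N S.spinDim} (h : IsVector S Φ) {b : ℕ → ℂ}
    {B : ℝ≥0∞} (hB : B ≠ ⊤) (hb : ∀ n, ‖b n‖ₑ ^ 2 ≤ B) : IsVector S (levelMul b Φ) where
  measurable n s l := (h.measurable n s l).const_mul (b n)
  normSq_lt_top := (weighted_levelMul_le hb _ Φ).trans_lt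
    (ENNReal.mul_lt_top hB.lt_top h.normSq_lt_top)
  statistics := by
    have hs := h.statistics
    cases S with
    | fermi =>
      intro τ n s l X K
      rw [levelMul_apply, levelMul_apply, hs τ n s l X K, mul_left_comm]
    | bose =>
      intro τ n s l X K
      rw [levelMul_apply, levelMul_apply, hs τ n s l X K]
    | boltzmann => trivial
  photon_symm n τ s l X K := by
    rw [levelMul_apply, levelMul_apply, h.photon_symm]

theorem IsWeakGradient.levelMul {Φ : Wave N d} {G : Fin N → Fin 3 → Wave N d}
    (h : IsWeakGradient Φ G) {b : ℕ → ℂ} {B : ℝ≥0∞} (hB : B ≠ ⊤) (hb : ∀ n, ‖b n‖ₑ ^ 2 ≤ B) :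
    IsWeakGradient (levelMul b Φ) (fun j i => levelMul b (G j i)) where
  measurable j i n s l := (h.measurable j i n s l).const_mul (b n)
  normSq_lt_top j i := (weighted_levelMul_le hb _ _).trans_lt
    (ENNReal.mul_lt_top hB.lt_top (h.normSq_lt_top j i))
  weak j i n s l φ hφ hφc := by
    simp only [levelMul_apply, mul_left_comm _ (b n), integral_const_mul,
      h.weak j i n s l φ hφ hφc, mul_neg]

/-- The mass may change from `m` to `m'`: it enters the form domain only through the field energy,
whose finiteness is supplied separately. -/
theorem InFormDomain.levelMul {S : Statistics} {m m' : ℝ} {v : E3 → ℝ} {I : (Fin N → E3) → ℝ}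
    {Φ : Wave N S.spinDim} {G : Fin N → Fin 3 → Wave N S.spinDim}
    (h : InFormDomain S m v I Φ G) {b : ℕ → ℂ} {B : ℝ≥0∞} (hB : B ≠ ⊤)
    (hb : ∀ n, ‖b n‖ₑ ^ 2 ≤ B) (hm : fieldEnergy m' (levelMul b Φ) < ⊤) :
    InFormDomain S m' v I (levelMul b Φ) (fun j i => levelMul b (G j i)) where
  isVector := h.isVector.levelMul hB hb
  isWeakGradient := h.isWeakGradient.levelMul hB hb
  field_lt_top := hm
  external_lt_top := (weighted_levelMul_le hb _ Φ).trans_lt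
    (ENNReal.mul_lt_top hB.lt_top h.external_lt_top)
  interaction_lt_top := (weighted_levelMul_le hb _ Φ).trans_lt
    (ENNReal.mul_lt_top hB.lt_top h.interaction_lt_top)

/-! ### Monotonicity in the photon mass. -/

theorem weighted_mono {w w' : (n : ℕ) → Config N n → ℝ≥0∞} (h : ∀ n z, w n z ≤ w' n z)
    (Φ : Wave N d) : weighted w Φ ≤ weighted w' Φ :=
  ENNReal.tsum_le_tsum fun n => Finset.sum_le_sum fun _ _ => Finset.sum_le_sum fun _ _ =>
    lintegral_mono fun z => mul_le_mul_left (h n z) _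

theorem fieldEnergy_zero_le (m : ℝ) (Φ : Wave N d) : fieldEnergy 0 Φ ≤ fieldEnergy m Φ :=
  weighted_mono (fun _ _ => Finset.sum_le_sum fun _ _ => ENNReal.ofReal_le_ofReal
    (Real.sqrt_le_sqrt (by simpa using sq_nonneg m))) Φ

theorem InFormDomain.mass_zero {S : Statistics} {m : ℝ} {v : E3 → ℝ} {I : (Fin N → E3) → ℝ}
    {Φ : Wave N S.spinDim} {G : Fin N → Fin 3 → Wave N S.spinDim}
    (h : InFormDomain S m v I Φ G) : InFormDomain S 0 v I Φ G :=
  { h with field_lt_top := (fieldEnergy_zero_le m Φ).trans_lt h.field_lt_top }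

/-- Every massive trial state is a massless one with no larger energy, because only the field energy
depends on the mass. -/
theorem groundEnergy_zero_le (S : Statistics) (α g Λ : ℝ) (I : (n : ℕ) → (Fin n → E3) → ℝ)
    (v : E3 → ℝ) (m : ℝ) (n : ℕ) :
    groundEnergy S α g Λ I v 0 n ≤ groundEnergy S α g Λ I v m n := by
  refine le_sInf ?_
  rintro e ⟨Φ, G, hd, hn, rfl⟩
  have h0 : groundEnergy S α g Λ I v 0 n ≤ energyForm S α g Λ 0 v (I n) Φ G :=
    sInf_le ⟨Φ, G, hd.mass_zero, hn, rfl⟩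
  refine h0.trans ?_
  exact add_le_add_right (EReal.coe_ennreal_le_coe_ennreal_iff.2 (fieldEnergy_zero_le m Φ)) _

theorem threshold_zero_le (S : Statistics) (α g Λ : ℝ) (I : (n : ℕ) → (Fin n → E3) → ℝ)
    (v : E3 → ℝ) (m : ℝ) (n : ℕ) :
    threshold S α g Λ I v 0 n ≤ threshold S α g Λ I v m n :=
  iInf_mono fun _ => add_le_add (groundEnergy_zero_le ..) (groundEnergy_zero_le ..)

/-! ### Bounds at fixed photon number for spin, inner product and potentials. -/

theorem measurable_annihilate {c : Fin 2 → E3 → E3 → ℂ}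
    (hc : ∀ q, Measurable fun p : E3 × E3 => c q p.1 p.2) (j : Fin N)
    {Φ : Wave N d} (hΦ : ∀ n s l, Measurable (Φ n s l)) (n : ℕ) (s : Fin N → Fin d)
    (l : Fin n → Fin 2) : Measurable (annihilate c j Φ n s l) := by
  have h1 : Measurable fun p : Config N n × E3 => (p.2, p.1.1 j) :=
    measurable_snd.prodMk ((measurable_pi_apply j).comp measurable_fst.fst)
  have h2 : Measurable fun p : Config N n × E3 => (p.2, p.1.2) :=
    measurable_snd.prodMk measurable_fst.snd
  have h3 := (measurable_insertNth (β := E3) (0 : Fin (n + 1))).comp h2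
  simp only [Function.comp_def, Fin.insertNth_zero'] at h3
  have h4 : Measurable fun p : Config N n × E3 =>
    ((p.1.1, (Fin.cons p.2 p.1.2 : Fin (n + 1) → E3)) : Config N (n + 1)) :=
    measurable_fst.fst.prodMk h3
  refine (Finset.measurable_fun_sum _ fun q _ => ?_).const_mul _
  exact (((hc q).comp h1).mul ((hΦ (n + 1) s (Fin.cons q l : Fin (n + 1) → Fin 2)).comp
    h4)).stronglyMeasurable.integral_prod_right'.measurable

/-- What counts is that `C` is finite and independent of `n` and `Ψ`, so that summable majorants
stay summable. -/
theorem levelSq_spinOp_le (S : Statistics) (j : Fin N) (i : Fin 3) :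
    ∃ C : ℝ≥0∞, C ≠ ⊤ ∧ ∀ (Ψ : Wave N S.spinDim) (n : ℕ), (∀ s l, Measurable (Ψ n s l)) →
      levelSq (spinOp S j i Ψ n) ≤ C * levelSq (Ψ n) := by
  let K : ℝ≥0∞ := ∑ a, ∑ b, ‖S.spinMatrix i a b‖ₑ ^ 2
  have hK : K ≠ ⊤ := by simp [K, ENNReal.sum_eq_top]
  refine ⟨∑ s : Fin N → Fin S.spinDim, S.spinDim * ∑ t : Fin S.spinDim, K, ?_,
    fun Ψ n hΨ => ?_⟩
  · simp [ENNReal.mul_eq_top, hK]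
  have hle : ∀ (s : Fin N → Fin S.spinDim) (l : Fin n → Fin 2),
      ∫⁻ z, ‖spinOp S j i Ψ n s l z‖ₑ ^ 2 ≤
        S.spinDim * ∑ t, K * ∫⁻ z, ‖Ψ n (Function.update s j t) l z‖ₑ ^ 2 := by
    intro s l
    have hm : ∀ t, Measurable fun z => ‖Ψ n (Function.update s j t) l z‖ₑ ^ 2 :=
      fun t => (hΨ _ _).enorm.pow_const 2
    calc _ ≤ ∫⁻ z, S.spinDim * ∑ t, K * ‖Ψ n (Function.update s j t) l z‖ₑ ^ 2 := by
          refine lintegral_mono fun z => (enorm_sum_sq_le_card_mul _).trans ?_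
          rw [Fintype.card_fin]
          gcongr with t
          rw [enorm_mul, mul_pow]
          gcongr
          exact (Finset.single_le_sum (f := fun b => ‖S.spinMatrix i (s j) b‖ₑ ^ 2)
            (fun _ _ => zero_le) (Finset.mem_univ t)).trans
            (Finset.single_le_sum (f := fun a => ∑ b, ‖S.spinMatrix i a b‖ₑ ^ 2)
              (fun _ _ => zero_le) (Finset.mem_univ (s j)))
      _ = _ := by
          rw [lintegral_const_mul' _ _ (by simp), lintegral_finsetSum _ fun t _ =>
            (hm t).const_mul K]
          simp only [lintegral_const_mul' _ _ hK]
  rw [Finset.sum_mul]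
  simp only [levelSq, levelWeighted, one_mul]
  refine Finset.sum_le_sum fun s _ => ?_
  calc _ ≤ ∑ l, S.spinDim * ∑ t, K * ∫⁻ z, ‖Ψ n (Function.update s j t) l z‖ₑ ^ 2 :=
        Finset.sum_le_sum fun l _ => hle s l
    _ = S.spinDim * ∑ t, K * ∑ l, ∫⁻ z, ‖Ψ n (Function.update s j t) l z‖ₑ ^ 2 := by
        rw [← Finset.mul_sum, Finset.sum_comm]
        simp only [Finset.mul_sum]
    _ ≤ _ := by
        rw [mul_assoc, Finset.sum_mul]
        gcongr with t
        -- Since `s ↦ update s j t` is not injective, each term is bounded by the full spin sum;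
        -- hence the sum over `s` in the constant.
        exact Finset.single_le_sum (f := fun s => ∑ l, ∫⁻ z, ‖Ψ n s l z‖ₑ ^ 2)
          (fun _ _ => zero_le) (Finset.mem_univ _)

/-- The contribution of the amplitudes with `n` photons to the inner product. -/
def levelInner {n : ℕ} (F F' : Level N d n) : ℂ :=
  ∑ s, ∑ l, ∫ z, conj (F s l z) * F' s l z

theorem innerProd_eq_tsum (Φ Ψ : Wave N d) :
    innerProd Φ Ψ = ∑' n, levelInner (Φ n) (Ψ n) := rfl

theorem enorm_levelInner_le {n : ℕ} {F : Level N d n} (hF : ∀ s l, Measurable (F s l))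
    (F' : Level N d n) : ‖levelInner F F'‖ₑ ≤ levelSq F + levelSq F' := by
  simp only [levelSq, levelWeighted, one_mul, ← Finset.sum_add_distrib]
  refine (enorm_sum_le _ _).trans (Finset.sum_le_sum fun s _ => (enorm_sum_le _ _).trans
    (Finset.sum_le_sum fun l _ => ?_))
  rw [← lintegral_add_left ((hF s l).enorm.pow_const 2)]
  refine (enorm_integral_le_lintegral_enorm _).trans (lintegral_mono fun z => ?_)
  rw [enorm_mul, RCLike.enorm_conj]
  rcases le_total ‖F s l z‖ₑ ‖F' s l z‖ₑ with h | h
  · exact le_add_left ((mul_le_mul_left h _).trans (sq _).ge)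
  · exact le_add_right ((mul_le_mul_right h _).trans (sq _).ge)

theorem innerProd_levelMul_const (a : ℂ) (Φ Ψ : Wave N d) :
    innerProd (levelMul (fun _ => a) Φ) (levelMul (fun _ => a) Ψ)
      = (conj a * a) * innerProd Φ Ψ := by
  simp only [innerProd, levelMul_apply, map_mul, ← tsum_mul_left, Finset.mul_sum,
    ← integral_const_mul]
  refine tsum_congr fun n => Finset.sum_congr rfl fun s _ => Finset.sum_congr rfl fun l _ => ?_
  refine integral_congr_ae (Filter.Eventually.of_forall fun z => ?_)
  simp only
  ring

/-- The contribution of the amplitudes with `n` photons to a potential energy. -/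
def levelPotential {n : ℕ} (W : (Fin N → E3) → ℝ) (F : Level N d n) : ℝ :=
  ∑ s, ∑ l, ∫ z, W z.1 * ‖F s l z‖ ^ 2

theorem potentialEnergy_eq_tsum (W : (Fin N → E3) → ℝ) (Φ : Wave N d) :
    potentialEnergy W Φ = ∑' n, levelPotential W (Φ n) := rfl

theorem enorm_levelPotential_le {n : ℕ} (W : (Fin N → E3) → ℝ) (F : Level N d n) :
    ‖levelPotential W F‖ₑ ≤ levelWeighted (fun z => ‖W z.1‖ₑ) F := by
  refine (enorm_sum_le _ _).trans (Finset.sum_le_sum fun s _ => (enorm_sum_le _ _).trans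
    (Finset.sum_le_sum fun l _ => ?_))
  refine (enorm_integral_le_lintegral_enorm _).trans (lintegral_mono fun z => ?_)
  rw [enorm_mul, enorm_pow, enorm_norm]

theorem potentialEnergy_levelMul_const (a : ℂ) (W : (Fin N → E3) → ℝ) (Φ : Wave N d) :
    potentialEnergy W (levelMul (fun _ => a) Φ) = ‖a‖ ^ 2 * potentialEnergy W Φ := by
  simp only [potentialEnergy, levelMul_apply, norm_mul, mul_pow, ← tsum_mul_left, Finset.mul_sum,
    ← integral_const_mul, mul_left_comm]

/-! ### Convergence of all energy terms as the photon-number cutoff is removed. -/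

open Filter Topology

/-- The indicator of fewer than `M` photons. -/
def cut (M n : ℕ) : ℂ := if n < M then 1 else 0

theorem cut_of_lt {M n : ℕ} (h : n < M) : cut M n = 1 := if_pos h

theorem enorm_cut_sq_le (M n : ℕ) : ‖cut M n‖ₑ ^ 2 ≤ 1 := by
  unfold cut
  split_ifs <;> simp

/-- Dominated convergence for series whose terms are eventually constant in `M`. The condition `n +
1 < M` is the one under which the cutoff leaves level `n` of a field operator unchanged, as this
level involves `n + 1` photons. -/
theorem tendsto_tsum_of_eq_of_lt {E : Type*} [NormedAddCommGroup E] [CompleteSpace E]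
    {F : ℕ → ℕ → E} {L : ℕ → E} {D : ℕ → ℝ≥0∞} (hD : ∑' n, D n ≠ ⊤)
    (hle : ∀ M n, ‖F M n‖ₑ ≤ D n) (heq : ∀ M n, n + 1 < M → F M n = L n) :
    Tendsto (fun M => ∑' n, F M n) atTop (𝓝 (∑' n, L n)) := by
  refine tendsto_tsum_of_dominated_convergence (ENNReal.summable_toReal hD) (fun n => ?_)
    (Eventually.of_forall fun M n => ?_)
  · refine tendsto_const_nhds.congr' ?_
    filter_upwards [eventually_gt_atTop (n + 1)] with M hM
    exact (heq M n hM).symm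
  · rw [← toReal_enorm]
    exact ENNReal.toReal_mono (ENNReal.ne_top_of_tsum_ne_top hD n) (hle M n)

theorem tendsto_toReal_tsum_of_eq_of_lt {f : ℕ → ℕ → ℝ≥0∞} {L D : ℕ → ℝ≥0∞}
    (hD : ∑' n, D n ≠ ⊤) (hle : ∀ M n, f M n ≤ D n) (heq : ∀ M n, n + 1 < M → f M n = L n) :
    Tendsto (fun M => (∑' n, f M n).toReal) atTop (𝓝 (∑' n, L n).toReal) := by
  have hf : ∀ M n, f M n ≠ ⊤ := fun M n =>
    ne_top_of_le_ne_top (ENNReal.ne_top_of_tsum_ne_top hD n) (hle M n)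
  have hL : ∀ n, L n ≠ ⊤ := fun n => by
    rw [← heq (n + 2) n (by omega)]
    exact hf _ n
  simp only [ENNReal.tsum_toReal_eq hL, ENNReal.tsum_toReal_eq (hf _)]
  refine tendsto_tsum_of_eq_of_lt hD (fun M n => ?_) fun M n h => by rw [heq M n h]
  rw [Real.enorm_eq_ofReal ENNReal.toReal_nonneg, ENNReal.ofReal_toReal (hf M n)]
  exact hle M n

theorem tendsto_weighted_cut (w : (n : ℕ) → Config N n → ℝ≥0∞) {Φ : Wave N d}
    (h : weighted w Φ < ⊤) : Tendsto (fun M => (weighted w (levelMul (cut M) Φ)).toReal) atTop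
      (𝓝 (weighted w Φ).toReal) := by
  simp only [weighted_eq_tsum] at h ⊢
  refine tendsto_toReal_tsum_of_eq_of_lt h.ne (fun M n => ?_) fun M n hn => ?_
  · rw [levelMul, levelWeighted_smul]
    exact mul_le_of_le_one_left zero_le (enorm_cut_sq_le M n)
  · rw [levelMul, cut_of_lt (by omega), one_smul]

theorem tendsto_potentialEnergy_cut (W : (Fin N → E3) → ℝ) {Φ : Wave N d}
    (h : weighted (fun _ z => ‖W z.1‖ₑ) Φ < ⊤) :
    Tendsto (fun M => potentialEnergy W (levelMul (cut M) Φ)) atTop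
      (𝓝 (potentialEnergy W Φ)) := by
  rw [weighted_eq_tsum] at h
  simp only [potentialEnergy_eq_tsum]
  refine tendsto_tsum_of_eq_of_lt h.ne (fun M n => ?_) fun M n hn => ?_
  · refine (enorm_levelPotential_le W _).trans ?_
    rw [levelMul, levelWeighted_smul]
    exact mul_le_of_le_one_left zero_le (enorm_cut_sq_le M n)
  · rw [levelMul, cut_of_lt (by omega), one_smul]

theorem measurable_field (hc : ∀ q, Measurable fun p : E3 × E3 => c q p.1 p.2) (j : Fin N)
    {Φ : Wave N d} (hΦ : ∀ n s l, Measurable (Φ n s l)) (n : ℕ) (s : Fin N → Fin d)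
    (l : Fin n → Fin 2) : Measurable (field c j Φ n s l) :=
  (measurable_annihilate hc j hΦ n s l).add (measurable_create hc j hΦ n s l)

theorem field_cut_of_lt (j : Fin N) (Φ : Wave N d) {M n : ℕ} (h : n + 1 < M) :
    field c j (levelMul (cut M) Φ) n = field c j Φ n := by
  rw [field_levelMul, cut_of_lt h, cut_of_lt (by omega), one_smul, one_smul]
  rfl

/-- Annihilation and creation parts are estimated separately because near `n = M` the cutoff may
keep one and drop the other. The bound does not depend on `M`. -/
theorem levelSq_field_cut_le (hc : ∀ q, Measurable fun p : E3 × E3 => c q p.1 p.2) (j : Fin N)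
    {Φ : Wave N d} (hΦ : ∀ n s l, Measurable (Φ n s l)) (M n : ℕ) :
    levelSq (field c j (levelMul (cut M) Φ) n)
      ≤ 2 * (levelSq (annihilate c j Φ n) + levelSq (create c j Φ n)) := by
  rw [field_levelMul]
  have hm : ∀ s l, Measurable ((cut M (n + 1) • annihilate c j Φ n) s l) := fun s l =>
    (measurable_annihilate hc j hΦ n s l).const_mul _
  refine (levelSq_add_le hm _).trans ?_
  rw [levelSq_smul, levelSq_smul]
  gcongr
  · exact mul_le_of_le_one_left zero_le (enorm_cut_sq_le _ _)
  · exact mul_le_of_le_one_left zero_le (enorm_cut_sq_le _ _)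

section Convergence

variable {S : Statistics} {v : E3 → ℝ} {I : (Fin N → E3) → ℝ} {Φ : Wave N S.spinDim}
  {G : Fin N → Fin 3 → Wave N S.spinDim}

theorem tsum_levelSq_annihilate_create_ne_top (hc : IsFormFactor c u) (j : Fin N)
    (h : InFormDomain S 0 v I Φ G) :
    ∑' n, 2 * (levelSq (annihilate c j Φ n) + levelSq (create c j Φ n)) ≠ ⊤ := by
  rw [ENNReal.tsum_mul_left, ENNReal.tsum_add, ← normSq_eq_tsum, ← normSq_eq_tsum]
  have h1 := normSq_annihilate_lt_top hc j h.isVector.measurable h.isVector.photon_symm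
    h.field_lt_top
  have h2 := normSq_create_lt_top hc j h.isVector.measurable h.isVector.normSq_lt_top
    h.field_lt_top
  exact ENNReal.mul_ne_top (by simp) (ENNReal.add_ne_top.2 ⟨h1.ne, h2.ne⟩)

theorem tsum_kinetic_bound_ne_top (hc : IsFormFactor c u) (j : Fin N) (i : Fin 3) (a : ℂ)
    (h : InFormDomain S 0 v I Φ G) :
    ∑' n, 2 * (levelSq (G j i n) + ‖a‖ₑ ^ 2 *
      (2 * (levelSq (annihilate c j Φ n) + levelSq (create c j Φ n)))) ≠ ⊤ := by
  rw [ENNReal.tsum_mul_left, ENNReal.tsum_add, ENNReal.tsum_mul_left, ← normSq_eq_tsum]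
  exact ENNReal.mul_ne_top (by simp) (ENNReal.add_ne_top.2
    ⟨(h.isWeakGradient.normSq_lt_top j i).ne,
      ENNReal.mul_ne_top (by simp) (tsum_levelSq_annihilate_create_ne_top hc j h)⟩)

theorem levelSq_kinetic_cut_le (hc : IsFormFactor c u) (j : Fin N) (i : Fin 3) (a : ℂ)
    (h : InFormDomain S 0 v I Φ G) (M n : ℕ) :
    levelSq (((-Complex.I) • levelMul (cut M) (G j i) + a • field c j (levelMul (cut M) Φ)) n)
      ≤ 2 * (levelSq (G j i n) + ‖a‖ₑ ^ 2 *
      (2 * (levelSq (annihilate c j Φ n) + levelSq (create c j Φ n)))) := by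
  have hm : ∀ s l, Measurable (((-Complex.I) • levelMul (cut M) (G j i)) n s l) := fun s l =>
    ((h.isWeakGradient.measurable j i n s l).const_mul _).const_mul _
  refine (levelSq_add_le hm _).trans ?_
  rw [Pi.smul_apply, Pi.smul_apply, levelSq_smul, levelSq_smul, levelMul, levelSq_smul]
  gcongr
  · have : ‖-Complex.I‖ₑ = 1 := by rw [← ofReal_norm]; simp
    rw [this, one_pow, one_mul]
    exact mul_le_of_le_one_left zero_le (enorm_cut_sq_le _ _)
  · exact levelSq_field_cut_le hc.measurable j h.isVector.measurable M n

theorem kinetic_cut_of_lt (j : Fin N) (i : Fin 3) (a : ℂ) {M n : ℕ} (hn : n + 1 < M) :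
    ((-Complex.I) • levelMul (cut M) (G j i) + a • field c j (levelMul (cut M) Φ)) n
      = ((-Complex.I) • G j i + a • field c j Φ) n := by
  rw [Pi.add_apply, Pi.smul_apply, Pi.smul_apply, field_cut_of_lt j Φ hn, levelMul,
    cut_of_lt (by omega), one_smul]
  rfl

theorem normSq_kinetic_lt_top (hc : IsFormFactor c u) (j : Fin N) (i : Fin 3) (a : ℂ)
    (h : InFormDomain S 0 v I Φ G) :
    normSq ((-Complex.I) • G j i + a • field c j Φ) < ⊤ := by
  refine lt_of_le_of_lt ?_ (tsum_kinetic_bound_ne_top hc j i a h).lt_top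
  rw [normSq_eq_tsum]
  refine ENNReal.tsum_le_tsum fun n => ?_
  -- `M = n + 2` is the smallest cutoff with `n + 1 < M`, so the bound for truncated states also
  -- covers the full one.
  rw [← kinetic_cut_of_lt (M := n + 2) j i a (by omega)]
  exact levelSq_kinetic_cut_le hc j i a h _ n

theorem tendsto_normSq_kinetic_cut (hc : IsFormFactor c u) (j : Fin N) (i : Fin 3) (a : ℂ)
    (h : InFormDomain S 0 v I Φ G) :
    Tendsto (fun M => (normSq ((-Complex.I) • levelMul (cut M) (G j i)
        + a • field c j (levelMul (cut M) Φ))).toReal) atTop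
      (𝓝 (normSq ((-Complex.I) • G j i + a • field c j Φ)).toReal) := by
  simp only [normSq_eq_tsum]
  refine tendsto_toReal_tsum_of_eq_of_lt (tsum_kinetic_bound_ne_top hc j i a h)
    (levelSq_kinetic_cut_le hc j i a h) fun M n hn => ?_
  rw [kinetic_cut_of_lt j i a hn]

theorem kineticEnergy_lt_top (α Λ : ℝ) (h : InFormDomain S 0 v I Φ G) :
    kineticEnergy α Λ Φ G < ⊤ :=
  ENNReal.sum_lt_top.2 fun j _ => ENNReal.sum_lt_top.2 fun i _ =>
    normSq_kinetic_lt_top (isFormFactor_aCoeff Λ i) j i _ h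

theorem toReal_kineticEnergy (α Λ : ℝ) (h : InFormDomain S 0 v I Φ G) :
    (kineticEnergy α Λ Φ G).toReal = ∑ j : Fin N, ∑ i : Fin 3,
      (normSq ((-Complex.I) • G j i
        + ((Real.sqrt α : ℝ) : ℂ) • field (aCoeff Λ i) j Φ)).toReal := by
  have hfin := fun j i => normSq_kinetic_lt_top (isFormFactor_aCoeff Λ i) j i
    ((Real.sqrt α : ℝ) : ℂ) h
  rw [kineticEnergy, ENNReal.toReal_sum fun j _ =>
    (ENNReal.sum_lt_top.2 fun i _ => hfin j i).ne]
  exact Finset.sum_congr rfl fun j _ => ENNReal.toReal_sum fun i _ => (hfin j i).ne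

theorem inFormDomain_cut (h : InFormDomain S 0 v I Φ G) (M : ℕ) :
    InFormDomain S 0 v I (levelMul (cut M) Φ) (fun j i => levelMul (cut M) (G j i)) :=
  h.levelMul (B := 1) (by simp) (enorm_cut_sq_le M)
    ((weighted_levelMul_le (enorm_cut_sq_le M) _ Φ).trans_lt (by rw [one_mul]; exact h.field_lt_top))

theorem tendsto_kineticEnergy_cut (α Λ : ℝ) (h : InFormDomain S 0 v I Φ G) :
    Tendsto (fun M => (kineticEnergy α Λ (levelMul (cut M) Φ)
      (fun j i => levelMul (cut M) (G j i))).toReal) atTop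
      (𝓝 (kineticEnergy α Λ Φ G).toReal) := by
  rw [toReal_kineticEnergy α Λ h]
  refine Tendsto.congr (fun M => (toReal_kineticEnergy α Λ (inFormDomain_cut h M)).symm) ?_
  exact tendsto_finsetSum _ fun j _ => tendsto_finsetSum _ fun i _ =>
    tendsto_normSq_kinetic_cut (isFormFactor_aCoeff Λ i) j i _ h

theorem tendsto_innerProd_spinOp_field_cut (hc : IsFormFactor c u) (j : Fin N) (i : Fin 3)
    (h : InFormDomain S 0 v I Φ G) :
    Tendsto (fun M => innerProd (levelMul (cut M) Φ)
        (spinOp S j i (field c j (levelMul (cut M) Φ)))) atTop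
      (𝓝 (innerProd Φ (spinOp S j i (field c j Φ)))) := by
  obtain ⟨C, hC, hspin⟩ := levelSq_spinOp_le S j i
  simp only [innerProd_eq_tsum]
  refine tendsto_tsum_of_eq_of_lt (D := fun n => levelSq (Φ n) +
    C * (2 * (levelSq (annihilate c j Φ n) + levelSq (create c j Φ n)))) ?_ (fun M n => ?_)
    fun M n hn => ?_
  · rw [ENNReal.tsum_add, ENNReal.tsum_mul_left, ← normSq_eq_tsum]
    exact ENNReal.add_ne_top.2 ⟨h.isVector.normSq_lt_top.ne,
      ENNReal.mul_ne_top hC (tsum_levelSq_annihilate_create_ne_top hc j h)⟩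
  · have hcut := (inFormDomain_cut h M).isVector.measurable
    refine (enorm_levelInner_le (hcut n) _).trans (add_le_add ?_ ?_)
    · rw [levelMul, levelSq_smul]
      exact mul_le_of_le_one_left zero_le (enorm_cut_sq_le _ _)
    · refine (hspin _ n (measurable_field hc.measurable j hcut n)).trans ?_
      gcongr
      exact levelSq_field_cut_le hc.measurable j h.isVector.measurable M n
  · have hΦn : levelMul (cut M) Φ n = Φ n := by rw [levelMul, cut_of_lt (by omega), one_smul]
    have hs : spinOp S j i (field c j (levelMul (cut M) Φ)) n = spinOp S j i (field c j Φ) n := by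
      unfold spinOp
      rw [field_cut_of_lt j Φ hn]
    rw [hΦn, hs]

theorem tendsto_spinEnergy_cut (α g Λ : ℝ) (h : InFormDomain S 0 v I Φ G) :
    Tendsto (fun M => spinEnergy S α g Λ (levelMul (cut M) Φ)) atTop
      (𝓝 (spinEnergy S α g Λ Φ)) :=
  (tendsto_finsetSum _ fun j _ => tendsto_finsetSum _ fun i _ =>
    (Complex.continuous_re.tendsto _).comp
      (tendsto_innerProd_spinOp_field_cut (isFormFactor_bCoeff Λ i) j i h)).const_mul _

end Convergence

/-! ### Real-valued energy, normalization, and semicontinuity in the mass. -/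

/-- The real value of the energy form on the form domain. -/
def realEnergy (S : Statistics) (α g Λ m : ℝ) (v : E3 → ℝ) (I : (Fin N → E3) → ℝ)
    (Φ : Wave N S.spinDim) (G : Fin N → Fin 3 → Wave N S.spinDim) : ℝ :=
  (kineticEnergy α Λ Φ G).toReal + spinEnergy S α g Λ Φ
    + potentialEnergy (externalPotential N v) Φ + potentialEnergy I Φ + (fieldEnergy m Φ).toReal

section Energy

variable {S : Statistics} {α g Λ m : ℝ} {v : E3 → ℝ} {I : (Fin N → E3) → ℝ}
  {Φ : Wave N S.spinDim} {G : Fin N → Fin 3 → Wave N S.spinDim}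

/-- Kinetic and field energy are finite on the form domain, so limits and quotients can be taken in
`ℝ`. -/
theorem energyForm_eq_coe (α g Λ : ℝ) (h : InFormDomain S m v I Φ G) :
    energyForm S α g Λ m v I Φ G = (realEnergy S α g Λ m v I Φ G : ℝ) := by
  rw [energyForm, realEnergy, ← EReal.coe_ennreal_toReal h.field_lt_top.ne,
    ← EReal.coe_ennreal_toReal (kineticEnergy_lt_top α Λ h.mass_zero).ne]
  push_cast
  rfl

theorem tendsto_realEnergy_cut (α g Λ : ℝ) (h : InFormDomain S 0 v I Φ G) :
    Tendsto (fun M => realEnergy S α g Λ 0 v I (levelMul (cut M) Φ)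
      (fun j i => levelMul (cut M) (G j i))) atTop (𝓝 (realEnergy S α g Λ 0 v I Φ G)) :=
  ((((tendsto_kineticEnergy_cut α Λ h).add (tendsto_spinEnergy_cut α g Λ h)).add
    (tendsto_potentialEnergy_cut _ h.external_lt_top)).add
    (tendsto_potentialEnergy_cut _ h.interaction_lt_top)).add
    (tendsto_weighted_cut _ h.field_lt_top)

theorem toReal_enorm_sq_mul (a : ℂ) (t : ℝ≥0∞) : (‖a‖ₑ ^ 2 * t).toReal = ‖a‖ ^ 2 * t.toReal := by
  rw [ENNReal.toReal_mul, ENNReal.toReal_pow, toReal_enorm]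

theorem kineticEnergy_levelMul_const (a : ℂ) (α Λ : ℝ) (Φ : Wave N d)
    (G : Fin N → Fin 3 → Wave N d) :
    kineticEnergy α Λ (levelMul (fun _ => a) Φ) (fun j i => levelMul (fun _ => a) (G j i))
      = ‖a‖ₑ ^ 2 * kineticEnergy α Λ Φ G := by
  simp only [kineticEnergy, Finset.mul_sum]
  refine Finset.sum_congr rfl fun j _ => Finset.sum_congr rfl fun i _ => ?_
  rw [normSq, normSq, ← weighted_levelMul_const, field_levelMul_const]
  congr 1
  funext n s l z
  simp only [Pi.add_apply, Pi.smul_apply, smul_eq_mul, levelMul_apply]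
  ring

theorem spinEnergy_levelMul_const (a : ℂ) (α g Λ : ℝ) (Φ : Wave N S.spinDim) :
    spinEnergy S α g Λ (levelMul (fun _ => a) Φ) = ‖a‖ ^ 2 * spinEnergy S α g Λ Φ := by
  have ha : conj a * a = ((‖a‖ ^ 2 : ℝ) : ℂ) := by
    rw [mul_comm, Complex.mul_conj, Complex.normSq_eq_norm_sq]
  simp only [spinEnergy, field_levelMul_const, spinOp_levelMul, innerProd_levelMul_const, ha,
    Complex.re_ofReal_mul, ← Finset.mul_sum]
  ring

theorem realEnergy_levelMul_const (a : ℂ) (α g Λ m : ℝ) (v : E3 → ℝ) (I : (Fin N → E3) → ℝ)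
    (Φ : Wave N S.spinDim) (G : Fin N → Fin 3 → Wave N S.spinDim) :
    realEnergy S α g Λ m v I (levelMul (fun _ => a) Φ) (fun j i => levelMul (fun _ => a) (G j i))
      = ‖a‖ ^ 2 * realEnergy S α g Λ m v I Φ G := by
  rw [realEnergy, realEnergy, kineticEnergy_levelMul_const, spinEnergy_levelMul_const,
    potentialEnergy_levelMul_const, potentialEnergy_levelMul_const, fieldEnergy,
    weighted_levelMul_const, toReal_enorm_sq_mul, toReal_enorm_sq_mul, ← fieldEnergy]
  ring

theorem omega_le (hm : 0 ≤ m) (k : E3) : omega m k ≤ omega 0 k + m := by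
  rw [omega_zero, omega]
  refine Real.sqrt_le_iff.2 ⟨by positivity, ?_⟩
  nlinarith [mul_nonneg (norm_nonneg k) hm]

/-- Each of the fewer than `M` photons costs at most `m` more than in the massless case. -/
theorem fieldEnergy_cut_le (hm : 0 ≤ m) {Φ : Wave N d} (hΦ : ∀ n s l, Measurable (Φ n s l))
    (M : ℕ) :
    fieldEnergy m (levelMul (cut M) Φ) ≤ fieldEnergy 0 (levelMul (cut M) Φ)
      + ENNReal.ofReal (m * M) * normSq (levelMul (cut M) Φ) := by
  simp only [fieldEnergy, normSq, weighted_eq_tsum]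
  rw [← ENNReal.tsum_mul_left, ← ENNReal.tsum_add]
  refine ENNReal.tsum_le_tsum fun n => ?_
  by_cases hn : n < M
  · simp only [levelWeighted, Finset.mul_sum, ← Finset.sum_add_distrib, one_mul]
    refine Finset.sum_le_sum fun s _ => Finset.sum_le_sum fun l _ => ?_
    have hmeas : Measurable fun z => ‖levelMul (cut M) Φ n s l z‖ₑ ^ 2 :=
      ((hΦ n s l).const_mul _).enorm.pow_const 2
    rw [← lintegral_const_mul' _ _ ENNReal.ofReal_ne_top,
      ← lintegral_add_right _ (hmeas.const_mul _)]
    refine lintegral_mono fun z => ?_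
    rw [← add_mul]
    gcongr
    calc ∑ r, ENNReal.ofReal (omega m (z.2 r))
        ≤ ∑ r, (ENNReal.ofReal (omega 0 (z.2 r)) + ENNReal.ofReal m) :=
          Finset.sum_le_sum fun r _ => (ENNReal.ofReal_le_ofReal (omega_le hm _)).trans
            ENNReal.ofReal_add_le
      _ = ∑ r, ENNReal.ofReal (omega 0 (z.2 r)) + ENNReal.ofReal (m * n) := by
          rw [Finset.sum_add_distrib, Finset.sum_const, Finset.card_univ, Fintype.card_fin,
            nsmul_eq_mul, ENNReal.ofReal_mul hm, ENNReal.ofReal_natCast, mul_comm (n : ℝ≥0∞)]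
      _ ≤ _ := by gcongr
  · have : cut M n = 0 := if_neg hn
    rw [levelMul, this, levelWeighted_smul]
    simp

/-- States with a bounded number of photons are trial states for every photon mass, and their
energy depends on it continuously. -/
theorem exists_normalized_realEnergy_le (h : InFormDomain S 0 v I Φ G) (hm : 0 ≤ m) (M : ℕ)
    (hpos : 0 < (normSq (levelMul (cut M) Φ)).toReal) :
    ∃ (Ψ : Wave N S.spinDim) (G' : Fin N → Fin 3 → Wave N S.spinDim),
      InFormDomain S m v I Ψ G' ∧ normSq Ψ = 1 ∧ realEnergy S α g Λ m v I Ψ G'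
        ≤ realEnergy S α g Λ 0 v I (levelMul (cut M) Φ) (fun j i => levelMul (cut M) (G j i))
          / (normSq (levelMul (cut M) Φ)).toReal + m * M := by
  set Φ' := levelMul (cut M) Φ
  set ν := (normSq Φ').toReal
  have hd := inFormDomain_cut h M
  have hfin : fieldEnergy 0 Φ' + ENNReal.ofReal (m * M) * normSq Φ' ≠ ⊤ :=
    ENNReal.add_ne_top.2 ⟨hd.field_lt_top.ne,
      ENNReal.mul_ne_top ENNReal.ofReal_ne_top hd.isVector.normSq_lt_top.ne⟩
  have hE := fieldEnergy_cut_le hm h.isVector.measurable M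
  -- Truncation lowers the norm; this factor restores it, and the quadratic energy is divided by
  -- `ν`.
  let a : ℂ := (((Real.sqrt ν)⁻¹ : ℝ) : ℂ)
  have ha : ‖a‖ ^ 2 = ν⁻¹ := by
    rw [Complex.norm_real, Real.norm_eq_abs, sq_abs, inv_pow, Real.sq_sqrt hpos.le]
  refine ⟨levelMul (fun _ => a) Φ', fun j i => levelMul (fun _ => a) (levelMul (cut M) (G j i)),
    hd.levelMul (B := ‖a‖ₑ ^ 2) (by simp) (fun _ => le_rfl) ?_, ?_, ?_⟩
  · rw [fieldEnergy, weighted_levelMul_const, ← fieldEnergy]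
    exact ENNReal.mul_lt_top (by simp) (hE.trans_lt hfin.lt_top)
  · rw [normSq, weighted_levelMul_const, ← normSq]
    refine (ENNReal.toReal_eq_one_iff _).1 ?_
    rw [toReal_enorm_sq_mul, ha]
    exact inv_mul_cancel₀ hpos.ne'
  · rw [realEnergy_levelMul_const, ha, inv_mul_eq_div, div_add' _ _ _ hpos.ne']
    refine div_le_div_of_nonneg_right ?_ hpos.le
    have hE' := ENNReal.toReal_mono hfin hE
    rw [ENNReal.toReal_add hd.field_lt_top.ne
      (ENNReal.mul_ne_top ENNReal.ofReal_ne_top hd.isVector.normSq_lt_top.ne),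
      ENNReal.toReal_mul, ENNReal.toReal_ofReal (by positivity)] at hE'
    simp only [realEnergy]
    linarith

/-- The ground state energy is upper semicontinuous in the photon mass, from the right at `0`. -/
theorem exists_groundEnergy_lt_add (S : Statistics) (α g Λ : ℝ)
    (I : (n : ℕ) → (Fin n → E3) → ℝ) (v : E3 → ℝ) (n : ℕ) {r ε : ℝ} (hε : 0 < ε)
    (hr : groundEnergy S α g Λ I v 0 n < (r : EReal)) :
    ∃ m₀ : ℝ, 0 < m₀ ∧ ∀ m : ℝ, 0 < m → m < m₀ →
      groundEnergy S α g Λ I v m n < ((r + ε : ℝ) : EReal) := by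
  obtain ⟨_, ⟨Φ, G, hd, hn, rfl⟩, hlt⟩ := sInf_lt_iff.1 hr
  rw [energyForm_eq_coe α g Λ hd, EReal.coe_lt_coe_iff] at hlt
  have hν := tendsto_weighted_cut _ hd.isVector.normSq_lt_top
  rw [← normSq, hn, ENNReal.toReal_one] at hν
  -- The energy quotients of the truncated states tend to the energy of `Φ`, which is below `r`.
  have hq := (tendsto_realEnergy_cut α g Λ hd).div hν one_ne_zero
  rw [div_one] at hq
  obtain ⟨M, hM, hpos⟩ :=
    ((hq.eventually_lt_const hlt).and (hν.eventually_const_lt one_pos)).exists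
  -- This choice makes `m M < ε`; the `+ 1` covers `M = 0`.
  refine ⟨ε / (M + 1), by positivity, fun m hm hmlt => ?_⟩
  obtain ⟨Ψ, G', hd', hn', hle⟩ :=
    exists_normalized_realEnergy_le (α := α) (g := g) (Λ := Λ) hd hm.le M hpos
  have hmem : groundEnergy S α g Λ I v m n ≤ energyForm S α g Λ m v (I n) Ψ G' :=
    sInf_le ⟨Ψ, G', hd', hn', rfl⟩
  refine hmem.trans_lt ?_
  rw [energyForm_eq_coe α g Λ hd', EReal.coe_lt_coe_iff]
  rw [lt_div_iff₀ (by positivity)] at hmlt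
  have hM' : realEnergy S α g Λ 0 v (I n) (levelMul (cut M) Φ)
    (fun j i => levelMul (cut M) (G j i)) / (normSq (levelMul (cut M) Φ)).toReal < r := hM
  linarith

end Energy

end QED

end

/-! ### The stability of the binding condition. -/

theorem lemma5p4 (S : QED.Statistics) (α g Λ : ℝ) (hα : 0 ≤ α) (hΛ : 0 < Λ)
    (v : QED.E3 → ℝ) (I : (n : ℕ) → (Fin n → QED.E3) → ℝ)
    (hv : Measurable v) (hI : ∀ n, Measurable (I n))
    (hI_symm : ∀ (n : ℕ) (τ : Equiv.Perm (Fin n)) (X : Fin n → QED.E3), I n (X ∘ τ) = I n X)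
    (hI_transl : ∀ (n : ℕ) (y : QED.E3) (X : Fin n → QED.E3), I n (fun j => X j + y) = I n X)
    (N : ℕ) (hbound : ∀ n ≤ N, QED.NegPartFormBounded S n v (I n))
    (ε : ℝ) (hε : 0 < ε)
    (hbinding : QED.groundEnergy S α g Λ I v 0 N
      < QED.threshold S α g Λ I v 0 N - ((2 * ε : ℝ) : EReal)) :
    ∃ m₀ : ℝ, 0 < m₀ ∧ ∀ m : ℝ, 0 < m → m < m₀ →
      QED.groundEnergy S α g Λ I v m N
        < QED.threshold S α g Λ I v m N - ((ε : ℝ) : EReal) := by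
  obtain ⟨r, hr, hrT⟩ := EReal.lt_iff_exists_real_btwn.1 hbinding
  obtain ⟨m₀, hm₀, h⟩ := QED.exists_groundEnergy_lt_add S α g Λ I v N hε hr
  refine ⟨m₀, hm₀, fun m hm hlt => (h m hm hlt).trans_le ?_⟩
  -- Half of the gap `2ε` is spent on the increase of the energy. The threshold can be infinite, for
  -- instance `⊤` when `N = 0`, so the cases are treated apart.
  have hT : ((r + ε : ℝ) : EReal) ≤ QED.threshold S α g Λ I v 0 N - ((ε : ℝ) : EReal) := by
    generalize QED.threshold S α g Λ I v 0 N = T at hrT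
    induction T with
    | bot => simp at hrT
    | top => simp
    | coe t =>
      rw [← EReal.coe_sub, EReal.coe_lt_coe_iff] at hrT
      rw [← EReal.coe_sub, EReal.coe_le_coe_iff]
      linarith
  exact hT.trans (EReal.sub_le_sub (QED.threshold_zero_le S α g Λ I v m N) le_rfl)
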